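/- Let $\mathcal X$ be a finite nonempty set, $\mathcal Y$ a finite set, $W(y|x)$ a discrete memoryless channel from $\mathcal X$ to $\mathcal Y$, and $q:\mathcal X\times\mathcal Y\to[0,\infty)$ a decoding metric such that $W(y|x)>0$ implies $q(x,y)>0$. Put $W^n(\boldsymbol y|\boldsymbol x)=\prod_i W(y_i|x_i)$ and $q^n(\boldsymbol x,\boldsymbol y)=\prod_i q(x_i,y_i)$. A code of blocklength $n\ge 1$ with $M\ge1$ messages is a map $m\mapsto\boldsymbol x_m\in\mathcal X^n$; its rate is $\frac{\log M}{n}$. The decoder maps $\boldsymbol y$ to a message maximizing $q^n(\boldsymbol x_m,\boldsymbol y)$, ties being broken equiprobably; the probability of error is averaged over the messages. Let $\bar C_0^q$ be the supremum of the rates of codes with probability of error exactly zero, let $P_e^q(R,n)$ be the smallest probability of error over all codes of blocklength $n$ and rate at least $R$, let $E^q(R)=\limsup_{n\to\infty}-\frac1n\log P_e^q(R,n)$ and $E^q(0^+)=\lim_{R\to0^+}E^q(R)$ (in $[-\infty,+\infty]$). For $a,b\in\mathcal X$ let $\hat{\mathcal Y}_{a,b}=\{y: q(a,y)q(b,y)>0\}$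 and $$\mu_{a,b}(s)=-\log\sum_{y\in\hat{\mathcal Y}_{a,b}}W(y|a)\Big(\frac{q(b,y)}{q(a,y)}\Big)^s .$$ With the convention $\frac{\cdot}{0}=+\infty$, let $$\mathcal B=\Big\{(a,b): \min_{y:W(y|a)>0}\tfrac{q(a,y)}{q(b,y)}=\max_{y:W(y|b)>0}\tfrac{q(a,y)}{q(b,y)}\Big\},$$ let $A(a,b)\in(0,\infty)$ be the common value for $(a,b)\in\mathcal B$, and let $\hat{\mathcal Y}^A_{a,b}=\{y\in\hat{\mathcal Y}_{a,b}:\frac{q(a,y)}{q(b,y)}=A(a,b)\}$. Put $\hat\mu_{a,b}(s)=s\log A(a,b)-\log\sum_{y\in\hat{\mathcal Y}^A_{a,b}}W(y|a)$ for $(a,b)\in\mathcal B$ and $\hat\mu_{a,b}(s)=\mu_{a,b}(s)$ for $(a,b)\notin\mathcal B$. (The set $\mathcal B$ is symmetric and $A(b,a)=1/A(a,b)$ on it.) If $\bar C_0^q=0$, then $$E^q(0^+)\le E^q_{\rm up}(0^+):=\max_{Q\in\mathcal P(\mathcal X)}\ \sup_{s\ge0}\ \sum_{a,b\in\mathcal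 X}Q(a)Q(b)\,\hat\mu_{a,b}(s),$$ and, with the expurgated exponent $E^q_{\rm ex}(0^+):=\max_{Q\in\mathcal P(\mathcal X)}\sup_{s\ge0}\sum_{a,b\in\mathcal X}Q(a)Q(b)\,\mu_{a,b}(s)$, $$\big|E^q_{\rm up}(0^+)-E^q_{\rm ex}(0^+)\big|\le\frac12\max_{(a,b)\in\mathcal B}\Bigg(\log\frac{\sum_{y\in\hat{\mathcal Y}_{a,b}}W(y|a)}{\sum_{y\in\hat{\mathcal Y}^A_{a,b}}W(y|a)}+\log\frac{\sum_{y\in\hat{\mathcal Y}_{a,b}}W(y|b)}{\sum_{y\in\hat{\mathcal Y}^A_{a,b}}W(y|b)}\Bigg).$$ In particular, both maxima over $Q$ are attained and finite. -/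

import Mathlib

open Filter Topology
open scoped ENNReal

noncomputable section

namespace Mismatch

/-- A discrete memoryless channel with input alphabet `X` and finite output alphabet `Y`:
`W.prob x y` is the transition probability `W(y|x)`. -/
structure DMC (X Y : Type*) [Fintype Y] where
  prob : X → Y → ℝ
  nonneg : ∀ x y, 0 ≤ prob x y
  sum_eq_one : ∀ x, ∑ y, prob x y = 1

/-- A decoding metric `q : X × Y → [0, ∞)` such that `W(y|x) > 0` implies `q(x,y) > 0`. -/
structure DecodingMetric {X Y : Type*} [Fintype Y] (W : DMC X Y) where
  val : X → Y → ℝ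
  nonneg : ∀ x y, 0 ≤ val x y
  pos_of_prob_pos : ∀ x y, 0 < W.prob x y → 0 < val x y

/-- The function `-log` on `[0, ∞)` with `-log 0 = +∞`. -/
def negLog (x : ℝ) : EReal := -ENNReal.log (ENNReal.ofReal x)

section Coding

variable {X Y : Type*} [Fintype Y] {W : DMC X Y}

/-- `Wⁿ(y|x)`. -/
def blockProb (W : DMC X Y) {n : ℕ} (x : Fin n → X) (y : Fin n → Y) : ℝ :=
  ∏ i, W.prob (x i) (y i)

/-- `qⁿ(x,y)`. -/
def blockMetric (q : DecodingMetric W) {n : ℕ} (x : Fin n → X) (y : Fin n → Y) : ℝ :=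
  ∏ i, q.val (x i) (y i)

open Classical in
/-- The messages that maximize the decoding metric for the output sequence `y`. -/
def bestMessages (q : DecodingMetric W) {M n : ℕ} (c : Fin M → Fin n → X) (y : Fin n → Y) :
    Finset (Fin M) :=
  Finset.univ.filter fun m => ∀ m', blockMetric q (c m') y ≤ blockMetric q (c m) y

open Classical in
/-- The probability that the output sequence `y` is decoded to `m`, when ties are broken
equiprobably among the messages of maximal metric. -/
def decodeProb (q : DecodingMetric W) {M n : ℕ} (c : Fin M → Fin n → X) (y : Fin n → Y)
    (m : Fin M) : ℝ :=
  if m ∈ bestMessages q c y then 1 / ((bestMessages q c y).card : ℝ) else 0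

/-- The probability of error when message `m` is sent. -/
def errorProb (q : DecodingMetric W) {M n : ℕ} (c : Fin M → Fin n → X) (m : Fin M) : ℝ :=
  ∑ y : Fin n → Y, blockProb W (c m) y * (1 - decodeProb q c y m)

/-- The average probability of error of the code `c` with `M` codewords of blocklength `n`. -/
def avgErrorProb (q : DecodingMetric W) {M n : ℕ} (c : Fin M → Fin n → X) : ℝ :=
  (∑ m, errorProb q c m) / (M : ℝ)

/-- The rate `log M / n`. -/
def rate (M n : ℕ) : ℝ := Real.log (M : ℝ) / (n : ℝ)

/-- The zero-error capacity of the channel with mismatched decoding and equiprobable tie breaking: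
the supremum of the rates of the codes whose probability of error is exactly zero. -/
def zeroErrorCapacity (q : DecodingMetric W) : EReal :=
  ⨆ (n : ℕ) (M : ℕ) (c : Fin M → Fin n → X) (_ : 0 < n ∧ 0 < M ∧ avgErrorProb q c = 0),
    ((rate M n : ℝ) : EReal)

/-- The smallest probability of error over all codes with blocklength `n` and rate at least `R`. -/
def minErrorProb (q : DecodingMetric W) (R : ℝ) (n : ℕ) : ℝ≥0∞ :=
  ⨅ (M : ℕ) (c : Fin M → Fin n → X) (_ : 0 < M ∧ R ≤ rate M n), ENNReal.ofReal (avgErrorProb q c)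

/-- The mismatched reliability function, with values in `[-∞, ∞]`. -/
def reliability (q : DecodingMetric W) (R : ℝ) : EReal :=
  limsup (fun n : ℕ => -ENNReal.log (minErrorProb q R n) / (n : EReal)) atTop

end Coding

section SingleLetter

variable {X Y : Type*} [Fintype Y] {W : DMC X Y}

open Classical in
/-- The outputs `y` with `q(a,y) q(b,y) > 0`. -/
def jointSupport (q : DecodingMetric W) (a b : X) : Finset Y :=
  Finset.univ.filter fun y => 0 < q.val a y * q.val b y

/-- `μ_{a,b}(s)`, equal to `+∞` if the sum vanishes. -/
def mu (q : DecodingMetric W) (a b : X) (s : ℝ) : EReal :=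
  negLog (∑ y ∈ jointSupport q a b, W.prob a y * (q.val b y / q.val a y) ^ s)

/-- The ratio `q(a,y) / q(b,y)` in `[0, ∞]`, equal to `∞` if only `q(b,y)` vanishes.
(The case `0 / 0` does not occur below, because there `W(y|a) > 0` or `W(y|b) > 0`.) -/
def ratio (q : DecodingMetric W) (a b : X) (y : Y) : ℝ≥0∞ :=
  ENNReal.ofReal (q.val a y) / ENNReal.ofReal (q.val b y)

/-- The minimum of `q(a,y) / q(b,y)` over the outputs `y` with `W(y|a) > 0`. -/
def minRatio (q : DecodingMetric W) (a b : X) : ℝ≥0∞ :=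
  ⨅ (y : Y) (_ : 0 < W.prob a y), ratio q a b y

/-- The maximum of `q(a,y) / q(b,y)` over the outputs `y` with `W(y|b) > 0`. -/
def maxRatio (q : DecodingMetric W) (a b : X) : ℝ≥0∞ :=
  ⨆ (y : Y) (_ : 0 < W.prob b y), ratio q a b y

/-- The set `𝓑` of pairs for which the two ratios agree. -/
def tightPairs (q : DecodingMetric W) : Set (X × X) :=
  {p | minRatio q p.1 p.2 = maxRatio q p.1 p.2}

/-- `A(a,b)`, the common value of the two ratios; for a pair in `𝓑` it lies in `(0, ∞)`. -/
def tightRatio (q : DecodingMetric W) (a b : X) : ℝ := (minRatio q a b).toReal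

open Classical in
/-- The outputs `y` with `q(a,y) q(b,y) > 0` and `q(a,y) / q(b,y) = A(a,b)`. -/
def tightSupport (q : DecodingMetric W) (a b : X) : Finset Y :=
  (jointSupport q a b).filter fun y => q.val a y / q.val b y = tightRatio q a b

open Classical in
/-- `μ̂_{a,b}(s)`: the linear upper bound `s log A(a,b) - log ∑ W(y|a)` (sum over `tightSupport`)
for pairs in `𝓑`, and `μ_{a,b}(s)` for the other pairs. As `𝓑` is symmetric, `A(b,a) = 1 / A(a,b)`
and `tightSupport` is symmetric on `𝓑`, this also gives
`μ̂_{b,a}(s) = -s log A(a,b) - log ∑ W(y|b)` there. -/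
def muHat (q : DecodingMetric W) (a b : X) (s : ℝ) : EReal :=
  if (a, b) ∈ tightPairs q then
    ((s * Real.log (tightRatio q a b) : ℝ) : EReal) +
      negLog (∑ y ∈ tightSupport q a b, W.prob a y)
  else mu q a b s

/-- `sup_{s ≥ 0} ∑_{a,b} Q(a) Q(b) f_{a,b}(s)`. -/
def supForm [Fintype X] (f : X → X → ℝ → EReal) (Q : X → ℝ) : EReal :=
  ⨆ (s : ℝ) (_ : 0 ≤ s), ∑ a, ∑ b, ((Q a * Q b : ℝ) : EReal) * f a b s

/-- The logarithmic loss of replacing `jointSupport` by `tightSupport`, for both inputs of the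
pair. -/
def gapTerm (q : DecodingMetric W) (p : X × X) : ℝ :=
  Real.log ((∑ y ∈ jointSupport q p.1 p.2, W.prob p.1 y) /
      ∑ y ∈ tightSupport q p.1 p.2, W.prob p.1 y) +
    Real.log ((∑ y ∈ jointSupport q p.1 p.2, W.prob p.2 y) /
      ∑ y ∈ tightSupport q p.1 p.2, W.prob p.2 y)

end SingleLetter

end Mismatch

end

/-! Write d(a,b) for `maxLogRatio`. If `maxRatio` were below `minRatio` for some pair of letters,
the two codewords ab and ba would be decoded without error; hence zero capacity makes all pairs
`Confusable`. This says d(a,b) + d(b,a) ≥ 0, with equality exactly on 𝓑.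

The converse comes from one bad pair of codewords. At a positive rate the number of messages
outgrows every Ramsey number, so among the better half of the messages there are two, x and x',
whose joint type is close to a mixture of product distributions Q ⊗ Q
(`exists_jointType_near_mixture`). A bound E on the quadratic forms of μ̂(s) then bounds ∑ μ̂(s)
along this pair by n(E + small), for all s in a bounded range. The mixture is symmetric, so the pair
may be ordered with ∑ d(x,x') at least half of the total k = ∑ (d(x,x') + d(x',x)) ≥ 0.

The pairwise error then has two regimes (`exists_exp_le_pairError_of_ordered`). If k is small
compared with n, few positions lie outside 𝓑; keeping only outputs of maximal log-ratio makes the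
total log-ratio equal to ∑ d(x,x') ≥ 0, and the mass kept is compared with μ̂(0). Otherwise -∑ μ̂(s)
gains a linear amount over a range of s independent of n, and a Cramér-type tilt inside this range
gives an exponent close to ∑ μ̂(s).

For the gap, only symmetrized coefficients enter a quadratic form, which is the source of the factor
1/2; on 𝓑 the functions μ and μ̂ lie between lines of the same slope. Attainment of the maxima uses
compactness of the simplex and control of the symmetrized coefficients as s → ∞. -/

namespace Mismatch

/-! ### Single-letter quantities for confusable pairs -/

section SingleLetterFacts

variable {X Y : Type*} [Fintype Y] {W : DMC X Y}

lemma negLog_of_pos {x : ℝ} (hx : 0 < x) : negLog x = ((-Real.log x : ℝ) : EReal) := by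
  rw [negLog, ENNReal.log_ofReal_of_pos hx, EReal.coe_neg]

lemma mem_jointSupport {q : DecodingMetric W} {a b : X} {y : Y} :
    y ∈ jointSupport q a b ↔ 0 < q.val a y ∧ 0 < q.val b y := by
  have ha := q.nonneg a y
  have hb := q.nonneg b y
  simp only [jointSupport, Finset.mem_filter, Finset.mem_univ, true_and]
  constructor
  · intro h
    exact ⟨pos_of_mul_pos_left h hb, pos_of_mul_pos_right h ha⟩
  · rintro ⟨h1, h2⟩
    exact mul_pos h1 h2

lemma jointSupport_comm (q : DecodingMetric W) (a b : X) :
    jointSupport q a b = jointSupport q b a := by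
  ext y; rw [mem_jointSupport, mem_jointSupport, and_comm]

lemma exists_prob_pos (W : DMC X Y) (a : X) : ∃ y, 0 < W.prob a y := by
  by_contra! h
  have h1 := W.sum_eq_one a
  have h2 := Finset.sum_nonpos fun y (_ : y ∈ Finset.univ) => h y
  linarith

lemma maxRatio_inv (q : DecodingMetric W) (a b : X) : (maxRatio q a b)⁻¹ = minRatio q b a := by
  simp only [maxRatio, minRatio, ENNReal.inv_iSup]
  refine iInf_congr fun y => iInf_congr fun hy => ?_
  have := q.pos_of_prob_pos b y hy
  exact ENNReal.inv_div (Or.inl ENNReal.ofReal_ne_top) (Or.inl (by simpa using this))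

lemma exists_ratio_eq_minRatio (q : DecodingMetric W) (a b : X) :
    ∃ y, 0 < W.prob a y ∧ ratio q a b y = minRatio q a b := by
  classical
  obtain ⟨y, hy, hmin⟩ := Finset.exists_min_image (Finset.univ.filter fun y => 0 < W.prob a y)
    (ratio q a b) (by
      obtain ⟨y, hy⟩ := exists_prob_pos W a
      exact ⟨y, by simpa using hy⟩)
  simp only [Finset.mem_filter, Finset.mem_univ, true_and] at hy hmin
  exact ⟨y, hy, le_antisymm (le_iInf₂ fun y' hy' => hmin y' hy') (iInf₂_le y hy)⟩

lemma minRatio_pos (q : DecodingMetric W) (a b : X) : 0 < minRatio q a b := by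
  obtain ⟨y, hy, h⟩ := exists_ratio_eq_minRatio q a b
  rw [← h, ratio]
  exact ENNReal.div_pos (by simpa using q.pos_of_prob_pos a y hy) ENNReal.ofReal_ne_top

/-- No pair of inputs can be told apart without error by the decoding metric. -/
def Confusable (q : DecodingMetric W) : Prop := ∀ a b, minRatio q a b ≤ maxRatio q a b

variable {q : DecodingMetric W}

lemma Confusable.minRatio_ne_top (hq : Confusable q) (a b : X) : minRatio q a b ≠ ⊤ := by
  refine ne_top_of_le_ne_top ?_ (hq a b)
  rw [← ENNReal.inv_ne_zero, maxRatio_inv]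
  exact (minRatio_pos q b a).ne'

lemma Confusable.tightRatio_pos (hq : Confusable q) (a b : X) : 0 < tightRatio q a b :=
  ENNReal.toReal_pos (minRatio_pos q a b).ne' (hq.minRatio_ne_top a b)

lemma Confusable.minRatio_eq (hq : Confusable q) (a b : X) :
    minRatio q a b = ENNReal.ofReal (tightRatio q a b) :=
  (ENNReal.ofReal_toReal (hq.minRatio_ne_top a b)).symm

/-- Exchanging the letters inverts the ratio and turns the maximum into a minimum, so `tightRatio`,
which is used for all pairs and not only on 𝓑, encodes both extremes. -/
lemma Confusable.maxRatio_eq (hq : Confusable q) (a b : X) :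
    maxRatio q a b = ENNReal.ofReal (tightRatio q b a)⁻¹ := by
  rw [ENNReal.ofReal_inv_of_pos (hq.tightRatio_pos b a), ← hq.minRatio_eq, ← maxRatio_inv, inv_inv]

lemma ratio_eq_ofReal {a b : X} {y : Y} (hb : 0 < q.val b y) :
    ratio q a b y = ENNReal.ofReal (q.val a y / q.val b y) := by
  rw [ratio, ENNReal.ofReal_div_of_pos hb]

lemma Confusable.exists_ratio_eq_tightRatio (hq : Confusable q) (a b : X) :
    ∃ y ∈ jointSupport q a b, 0 < W.prob a y ∧ q.val a y / q.val b y = tightRatio q a b := by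
  obtain ⟨y, hy, h⟩ := exists_ratio_eq_minRatio q a b
  have ha := q.pos_of_prob_pos a y hy
  have hb : 0 < q.val b y := by
    refine lt_of_le_of_ne (q.nonneg b y) fun h0 => hq.minRatio_ne_top a b ?_
    rw [← h, ratio, ← h0, ENNReal.ofReal_zero, ENNReal.div_zero (by simpa using ha)]
  refine ⟨y, mem_jointSupport.2 ⟨ha, hb⟩, hy, ?_⟩
  rw [tightRatio, ← h, ratio_eq_ofReal hb, ENNReal.toReal_ofReal (by positivity)]

lemma Confusable.tightRatio_le (hq : Confusable q) {a b : X} {y : Y} (hy : 0 < W.prob a y)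
    (hb : 0 < q.val b y) : tightRatio q a b ≤ q.val a y / q.val b y := by
  have ha := q.pos_of_prob_pos a y hy
  have : minRatio q a b ≤ ratio q a b y := iInf₂_le y hy
  rw [hq.minRatio_eq, ratio_eq_ofReal hb] at this
  exact (ENNReal.ofReal_le_ofReal_iff (by positivity)).1 this

/-- The largest value of `log (q(b,y) / q(a,y))` over the outputs with `W(y|a) > 0`. -/
noncomputable def maxLogRatio (q : DecodingMetric W) (a b : X) : ℝ := -Real.log (tightRatio q a b)

lemma Confusable.maxLogRatio_add_nonneg (hq : Confusable q) (a b : X) :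
    0 ≤ maxLogRatio q a b + maxLogRatio q b a := by
  have h := hq a b
  have ha := hq.tightRatio_pos a b
  have hb := hq.tightRatio_pos b a
  rw [hq.minRatio_eq, hq.maxRatio_eq, ENNReal.ofReal_le_ofReal_iff (by positivity)] at h
  have := Real.log_le_log ha h
  rw [Real.log_inv] at this
  simp only [maxLogRatio]; linarith

/-- Taking logarithms turns membership in 𝓑 into the vanishing of a nonnegative symmetric gap. This
gap, summed over positions, later measures how far a pair of codewords is from lying in 𝓑. -/
lemma Confusable.mem_tightPairs_iff (hq : Confusable q) (a b : X) :
    (a, b) ∈ tightPairs q ↔ maxLogRatio q a b + maxLogRatio q b a = 0 := by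
  have ha := hq.tightRatio_pos a b
  have hb := hq.tightRatio_pos b a
  simp only [tightPairs, Set.mem_ofPred_eq, hq.minRatio_eq, hq.maxRatio_eq, maxLogRatio]
  rw [ENNReal.ofReal_eq_ofReal_iff ha.le (by positivity)]
  constructor
  · intro h; rw [h, Real.log_inv]; ring
  · intro h
    apply Real.log_injOn_pos ha (by simpa using hb : (tightRatio q b a)⁻¹ ∈ Set.Ioi 0)
    rw [Real.log_inv]; linarith

lemma Confusable.mem_tightPairs_comm (hq : Confusable q) (a b : X) :
    (a, b) ∈ tightPairs q ↔ (b, a) ∈ tightPairs q := by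
  rw [hq.mem_tightPairs_iff, hq.mem_tightPairs_iff, add_comm]

lemma Confusable.tightRatio_self (hq : Confusable q) (a : X) : tightRatio q a a = 1 := by
  obtain ⟨y, hy, _, h⟩ := hq.exists_ratio_eq_tightRatio a a
  rw [← h, div_self (mem_jointSupport.1 hy).1.ne']

lemma Confusable.self_mem_tightPairs (hq : Confusable q) (a : X) : (a, a) ∈ tightPairs q := by
  rw [hq.mem_tightPairs_iff, maxLogRatio, hq.tightRatio_self]; simp

/-- The log-ratio `log (q(b,y) / q(a,y))` of the decoding metric. -/
noncomputable def logRatio (q : DecodingMetric W) (a b : X) (y : Y) : ℝ :=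
  Real.log (q.val b y / q.val a y)

lemma exp_mul_logRatio {a b : X} {y : Y} (hy : y ∈ jointSupport q a b) (s : ℝ) :
    Real.exp (s * logRatio q a b y) = (q.val b y / q.val a y) ^ s := by
  obtain ⟨ha, hb⟩ := mem_jointSupport.1 hy
  rw [Real.rpow_def_of_pos (by positivity), logRatio, mul_comm]

lemma mem_tightSupport {a b : X} {y : Y} : y ∈ tightSupport q a b ↔
    y ∈ jointSupport q a b ∧ q.val a y / q.val b y = tightRatio q a b := by
  simp [tightSupport]

lemma Confusable.mem_tightSupport_iff (hq : Confusable q) {a b : X} {y : Y} :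
    y ∈ tightSupport q a b ↔ y ∈ jointSupport q a b ∧ logRatio q a b y = maxLogRatio q a b := by
  rw [mem_tightSupport]
  refine and_congr_right fun hy => ?_
  obtain ⟨ha, hb⟩ := mem_jointSupport.1 hy
  rw [logRatio, maxLogRatio, ← Real.log_inv]
  constructor
  · intro h; rw [← h, inv_div]
  · intro h
    have := Real.log_injOn_pos (Set.mem_Ioi.2 (by positivity))
      (Set.mem_Ioi.2 (inv_pos.2 (hq.tightRatio_pos a b))) h
    rw [← inv_div, this, inv_inv]

lemma Confusable.logRatio_le (hq : Confusable q) {a b : X} {y : Y} (hy : y ∈ jointSupport q a b)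
    (hw : 0 < W.prob a y) : logRatio q a b y ≤ maxLogRatio q a b := by
  obtain ⟨ha, hb⟩ := mem_jointSupport.1 hy
  have h := Real.log_le_log (hq.tightRatio_pos a b) (hq.tightRatio_le hw hb)
  rw [logRatio, maxLogRatio, ← inv_div, Real.log_inv]; linarith

lemma logRatio_comm (a b : X) (y : Y) : logRatio q b a y = -logRatio q a b y := by
  rw [logRatio, logRatio, ← Real.log_inv, inv_div]

lemma Confusable.exists_mem_tightSupport (hq : Confusable q) (a b : X) :
    ∃ y ∈ tightSupport q a b, 0 < W.prob a y := by
  obtain ⟨y, hy, hw, h⟩ := hq.exists_ratio_eq_tightRatio a b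
  exact ⟨y, mem_tightSupport.2 ⟨hy, h⟩, hw⟩

lemma Confusable.tightSupport_comm (hq : Confusable q) {a b : X} (h : (a, b) ∈ tightPairs q) :
    tightSupport q a b = tightSupport q b a := by
  have h0 := (hq.mem_tightPairs_iff a b).1 h
  ext y
  rw [hq.mem_tightSupport_iff, hq.mem_tightSupport_iff, jointSupport_comm, logRatio_comm a b]
  refine and_congr_right fun _ => ?_
  constructor <;> intro h <;> linarith

/-- The moment generating function of the log-ratio, restricted to the outputs in `T`. -/
noncomputable def tiltedMass (q : DecodingMetric W) (T : Finset Y) (a b : X) (s : ℝ) : ℝ :=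
  ∑ y ∈ T, W.prob a y * Real.exp (s * logRatio q a b y)

lemma tiltedMass_pos {T : Finset Y} {a : X} (b : X) (h : ∃ y ∈ T, 0 < W.prob a y) (s : ℝ) :
    0 < tiltedMass q T a b s := by
  obtain ⟨y, hy, hw⟩ := h
  exact Finset.sum_pos' (fun y _ => mul_nonneg (W.nonneg a y) (Real.exp_pos _).le)
    ⟨y, hy, mul_pos hw (Real.exp_pos _)⟩

lemma tiltedMass_zero (T : Finset Y) (a b : X) : tiltedMass q T a b 0 = ∑ y ∈ T, W.prob a y := by
  simp [tiltedMass]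

lemma tiltedMass_mono {T T' : Finset Y} (h : T ⊆ T') (a b : X) (s : ℝ) :
    tiltedMass q T a b s ≤ tiltedMass q T' a b s :=
  Finset.sum_le_sum_of_subset_of_nonneg h fun y _ _ =>
    mul_nonneg (W.nonneg a y) (Real.exp_pos _).le

lemma continuous_tiltedMass (T : Finset Y) (a b : X) : Continuous (tiltedMass q T a b) := by
  unfold tiltedMass; fun_prop

lemma Confusable.tiltedMass_tightSupport (hq : Confusable q) (a b : X) (s : ℝ) :
    tiltedMass q (tightSupport q a b) a b s =
      (∑ y ∈ tightSupport q a b, W.prob a y) * Real.exp (s * maxLogRatio q a b) := by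
  rw [tiltedMass, Finset.sum_mul]
  refine Finset.sum_congr rfl fun y hy => ?_
  rw [(hq.mem_tightSupport_iff.1 hy).2]

lemma Confusable.sum_tightSupport_pos (hq : Confusable q) (a b : X) :
    0 < ∑ y ∈ tightSupport q a b, W.prob a y := by
  rw [← tiltedMass_zero (q := q) _ a b]
  exact tiltedMass_pos b (hq.exists_mem_tightSupport a b) 0

lemma tightSupport_subset_jointSupport (q : DecodingMetric W) (a b : X) :
    tightSupport q a b ⊆ jointSupport q a b := fun _ hy => (mem_tightSupport.1 hy).1

lemma sum_prob_le_one (W : DMC X Y) (T : Finset Y) (a : X) : ∑ y ∈ T, W.prob a y ≤ 1 := by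
  rw [← W.sum_eq_one a]
  exact Finset.sum_le_sum_of_subset_of_nonneg (Finset.subset_univ T) fun y _ _ => W.nonneg a y

open Classical in
/-- The outputs that contribute to `μ̂_{a,b}`. -/
noncomputable def hatSupport (q : DecodingMetric W) (a b : X) : Finset Y :=
  if (a, b) ∈ tightPairs q then tightSupport q a b else jointSupport q a b

lemma tightSupport_subset_hatSupport (q : DecodingMetric W) (a b : X) :
    tightSupport q a b ⊆ hatSupport q a b := by
  rw [hatSupport]; split_ifs
  · exact subset_rfl
  · exact tightSupport_subset_jointSupport q a b

lemma hatSupport_subset_jointSupport (q : DecodingMetric W) (a b : X) :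
    hatSupport q a b ⊆ jointSupport q a b := by
  rw [hatSupport]; split_ifs
  · exact tightSupport_subset_jointSupport q a b
  · exact subset_rfl

/-- The real number `-log ∑_{y ∈ T} W(y|a) (q(b,y) / q(a,y))^s`. -/
noncomputable def realMu (q : DecodingMetric W) (T : Finset Y) (a b : X) (s : ℝ) : ℝ :=
  -Real.log (tiltedMass q T a b s)

lemma Confusable.tiltedMass_pos_of_subset (hq : Confusable q) {T : Finset Y} {a b : X}
    (hT : tightSupport q a b ⊆ T) (s : ℝ) : 0 < tiltedMass q T a b s := by
  obtain ⟨y, hy, hw⟩ := hq.exists_mem_tightSupport a b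
  exact tiltedMass_pos b ⟨y, hT hy, hw⟩ s

lemma Confusable.mu_eq (hq : Confusable q) (a b : X) (s : ℝ) :
    mu q a b s = (realMu q (jointSupport q a b) a b s : EReal) := by
  rw [mu, realMu, ← negLog_of_pos
    (hq.tiltedMass_pos_of_subset (tightSupport_subset_jointSupport q a b) s), tiltedMass]
  congr 1
  exact Finset.sum_congr rfl fun y hy => by rw [exp_mul_logRatio hy]

lemma Confusable.muHat_eq (hq : Confusable q) (a b : X) (s : ℝ) :
    muHat q a b s = (realMu q (hatSupport q a b) a b s : EReal) := by
  rw [muHat, hatSupport]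
  split_ifs with h
  · have h0 := hq.sum_tightSupport_pos a b
    rw [realMu, hq.tiltedMass_tightSupport, Real.log_mul h0.ne' (Real.exp_pos _).ne', Real.log_exp,
      negLog_of_pos h0, ← EReal.coe_add, maxLogRatio]
    congr 1; ring
  · exact hq.mu_eq a b s

/-- Outputs in `tightSupport` alone already contribute an exact exponential. Together with
`le_realMu` this traps `realMu` between two lines of slope `-maxLogRatio`. -/
lemma Confusable.realMu_le (hq : Confusable q) {T : Finset Y} {a b : X}
    (hT : tightSupport q a b ⊆ T) (s : ℝ) :
    realMu q T a b s ≤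
      -Real.log (∑ y ∈ tightSupport q a b, W.prob a y) - s * maxLogRatio q a b := by
  have h := Real.log_le_log (hq.tiltedMass_pos_of_subset subset_rfl s)
    (tiltedMass_mono hT a b s)
  rw [hq.tiltedMass_tightSupport, Real.log_mul (hq.sum_tightSupport_pos a b).ne'
    (Real.exp_pos _).ne', Real.log_exp] at h
  rw [realMu]; linarith

lemma Confusable.le_realMu (hq : Confusable q) {T : Finset Y} {a b : X}
    (hT : tightSupport q a b ⊆ T) (hT' : T ⊆ jointSupport q a b) {s : ℝ} (hs : 0 ≤ s) :
    -Real.log (∑ y ∈ T, W.prob a y) - s * maxLogRatio q a b ≤ realMu q T a b s := by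
  have h0 := hq.tiltedMass_pos_of_subset hT 0
  rw [tiltedMass_zero] at h0
  have h : tiltedMass q T a b s ≤ (∑ y ∈ T, W.prob a y) * Real.exp (s * maxLogRatio q a b) := by
    rw [tiltedMass, Finset.sum_mul]
    refine Finset.sum_le_sum fun y hy => ?_
    rcases (W.nonneg a y).eq_or_lt with hw | hw
    · simp [← hw]
    · exact mul_le_mul_of_nonneg_left (Real.exp_le_exp.2
        (mul_le_mul_of_nonneg_left (hq.logRatio_le (hT' hy) hw) hs)) hw.le
  have := Real.log_le_log (hq.tiltedMass_pos_of_subset hT s) h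
  rw [Real.log_mul h0.ne' (Real.exp_pos _).ne', Real.log_exp] at this
  rw [realMu]; linarith

lemma Confusable.continuous_realMu (hq : Confusable q) {T : Finset Y} {a b : X}
    (hT : tightSupport q a b ⊆ T) : Continuous (realMu q T a b) :=
  ((continuous_tiltedMass T a b).log fun s => (hq.tiltedMass_pos_of_subset hT s).ne').neg

lemma Confusable.realMu_zero_nonneg (hq : Confusable q) {T : Finset Y} {a b : X}
    (hT : tightSupport q a b ⊆ T) : 0 ≤ realMu q T a b 0 := by
  have h := hq.tiltedMass_pos_of_subset hT 0
  rw [realMu, neg_nonneg]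
  refine Real.log_nonpos h.le ?_
  rw [tiltedMass_zero]; exact sum_prob_le_one W T a

lemma Confusable.realMu_tightSupport (hq : Confusable q) (a b : X) (s : ℝ) :
    realMu q (tightSupport q a b) a b s =
      -Real.log (∑ y ∈ tightSupport q a b, W.prob a y) - s * maxLogRatio q a b := by
  rw [realMu, hq.tiltedMass_tightSupport, Real.log_mul (hq.sum_tightSupport_pos a b).ne'
    (Real.exp_pos _).ne', Real.log_exp]
  ring

end SingleLetterFacts

/-! ### A Cramér-type lower bound on a finite grid of tilts -/

section LargeDeviations

variable {ι Y : Type*}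

/-- A derivative-free bound on the second difference of the log-moment generating function.
Averaging the double sum over (y, y') with its exchange replaces exp(h(z - z')) by a hyperbolic
cosine, which is at most exp(h²(z - z')²/2), and |z - z'| ≤ 2ρ. -/
lemma sum_mul_exp_mul_sum_mul_exp_le {T : Finset Y} {w z : Y → ℝ} (hw : ∀ y, 0 ≤ w y) {ρ : ℝ}
    (hz : ∀ y ∈ T, |z y| ≤ ρ) (s h : ℝ) :
    (∑ y ∈ T, w y * Real.exp ((s + h) * z y)) * (∑ y ∈ T, w y * Real.exp ((s - h) * z y)) ≤
      (∑ y ∈ T, w y * Real.exp (s * z y)) ^ 2 * Real.exp (2 * ρ ^ 2 * h ^ 2) := by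
  have key : ∀ y ∈ T, ∀ y' ∈ T,
      Real.cosh (h * (z y - z y')) ≤ Real.exp (2 * ρ ^ 2 * h ^ 2) := by
    intro y hy y' hy'
    refine (Real.cosh_le_exp_half_sq _).trans (Real.exp_le_exp.2 ?_)
    have h1 := abs_le.1 (hz y hy)
    have h2 := abs_le.1 (hz y' hy')
    have h3 : (z y - z y') ^ 2 ≤ (2 * ρ) ^ 2 := sq_le_sq' (by linarith) (by linarith)
    nlinarith [mul_le_mul_of_nonneg_left h3 (sq_nonneg h)]
  have e1 : (∑ y ∈ T, w y * Real.exp ((s + h) * z y)) *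
      (∑ y ∈ T, w y * Real.exp ((s - h) * z y)) =
      ∑ y ∈ T, ∑ y' ∈ T, w y * w y' * Real.exp (s * z y) * Real.exp (s * z y') *
        Real.exp (h * (z y - z y')) := by
    rw [Finset.sum_mul_sum]
    refine Finset.sum_congr rfl fun y _ => Finset.sum_congr rfl fun y' _ => ?_
    have : Real.exp ((s + h) * z y) * Real.exp ((s - h) * z y') =
        Real.exp (s * z y) * Real.exp (s * z y') * Real.exp (h * (z y - z y')) := by
      rw [← Real.exp_add, ← Real.exp_add, ← Real.exp_add]; congr 1; ring
    linear_combination (w y * w y') * this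
  have e2 : ∑ y ∈ T, ∑ y' ∈ T, w y * w y' * Real.exp (s * z y) * Real.exp (s * z y') *
        Real.exp (h * (z y - z y')) =
      ∑ y ∈ T, ∑ y' ∈ T, w y * w y' * Real.exp (s * z y) * Real.exp (s * z y') *
        Real.exp (-(h * (z y - z y'))) := by
    rw [Finset.sum_comm]
    refine Finset.sum_congr rfl fun y _ => Finset.sum_congr rfl fun y' _ => ?_
    rw [show h * (z y' - z y) = -(h * (z y - z y')) by ring]; ring
  have e3 : (∑ y ∈ T, w y * Real.exp ((s + h) * z y)) *
      (∑ y ∈ T, w y * Real.exp ((s - h) * z y)) =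
      ∑ y ∈ T, ∑ y' ∈ T, w y * w y' * Real.exp (s * z y) * Real.exp (s * z y') *
        Real.cosh (h * (z y - z y')) := by
    have : ∀ x : ℝ, x = (x + x) / 2 := fun x => by ring
    rw [this ((∑ y ∈ T, w y * Real.exp ((s + h) * z y)) *
      (∑ y ∈ T, w y * Real.exp ((s - h) * z y)))]
    nth_rewrite 2 [e1]
    rw [e1, e2]
    nth_rewrite 1 [← e2]
    rw [← Finset.sum_add_distrib, Finset.sum_div]
    refine Finset.sum_congr rfl fun y _ => ?_
    rw [← Finset.sum_add_distrib, Finset.sum_div]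
    refine Finset.sum_congr rfl fun y' _ => ?_
    rw [Real.cosh_eq]; ring
  rw [e3, sq, Finset.sum_mul_sum, Finset.sum_mul]
  refine Finset.sum_le_sum fun y hy => ?_
  rw [Finset.sum_mul]
  refine Finset.sum_le_sum fun y' hy' => ?_
  have h0 : 0 ≤ w y * w y' * Real.exp (s * z y) * Real.exp (s * z y') := by
    have := hw y; have := hw y'; positivity
  calc _ ≤ w y * w y' * Real.exp (s * z y) * Real.exp (s * z y') * Real.exp (2 * ρ ^ 2 * h ^ 2) :=
        mul_le_mul_of_nonneg_left (key y hy y' hy') h0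
    _ = _ := by ring

variable [Fintype ι] [DecidableEq ι]

lemma prod_sum_mul_exp (T : ι → Finset Y) (w z : ι → Y → ℝ) (s : ℝ) :
    ∏ i, ∑ y ∈ T i, w i y * Real.exp (s * z i y) =
      ∑ y ∈ Fintype.piFinset T, (∏ i, w i (y i)) * Real.exp (s * ∑ i, z i (y i)) := by
  rw [Finset.prod_univ_sum]
  refine Finset.sum_congr rfl fun y _ => ?_
  rw [Finset.prod_mul_distrib, Finset.mul_sum, Real.exp_sum]

/-- The inequality holds pointwise: 1 - exp(-hS) - exp(h(S - B)) is at most 0 outside the window [0,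
B] and at most 1 inside, where also exp(s(S - B)) ≤ 1. Thus the tilted mass outside the window is
removed by two Chernoff terms. -/
lemma le_sum_filter_nonneg {κ : Type*} (A : Finset κ) {p S : κ → ℝ} (hp : ∀ y ∈ A, 0 ≤ p y)
    {s h B : ℝ} (hs : 0 ≤ s) (hh : 0 ≤ h) :
    Real.exp (-(s * B)) * ((∑ y ∈ A, p y * Real.exp (s * S y)) -
        (∑ y ∈ A, p y * Real.exp ((s - h) * S y)) -
        Real.exp (-(h * B)) * ∑ y ∈ A, p y * Real.exp ((s + h) * S y)) ≤
      ∑ y ∈ A with 0 ≤ S y, p y := by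
  rw [Finset.sum_filter, Finset.mul_sum, ← Finset.sum_sub_distrib, ← Finset.sum_sub_distrib,
    Finset.mul_sum]
  refine Finset.sum_le_sum fun y hy => ?_
  have hpy := hp y hy
  have e1 : Real.exp ((s - h) * S y) = Real.exp (s * S y) * Real.exp (-(h * S y)) := by
    rw [← Real.exp_add]; congr 1; ring
  have e2 : Real.exp (-(h * B)) * Real.exp ((s + h) * S y) =
      Real.exp (s * S y) * Real.exp (h * (S y - B)) := by
    rw [← Real.exp_add, ← Real.exp_add]; congr 1; ring
  have e3 : Real.exp (-(s * B)) * (p y * Real.exp (s * S y) - p y * Real.exp ((s - h) * S y) -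
      Real.exp (-(h * B)) * (p y * Real.exp ((s + h) * S y))) =
      p y * (Real.exp (s * (S y - B)) *
        (1 - Real.exp (-(h * S y)) - Real.exp (h * (S y - B)))) := by
    have e4 : Real.exp (s * (S y - B)) = Real.exp (-(s * B)) * Real.exp (s * S y) := by
      rw [← Real.exp_add]; congr 1; ring
    rw [e4, e1]
    linear_combination (-(Real.exp (-(s * B)) * p y)) * e2
  rw [e3]
  have p1 := Real.exp_pos (s * (S y - B))
  have p2 := Real.exp_pos (-(h * S y))
  have p3 := Real.exp_pos (h * (S y - B))
  split_ifs with h0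
  · refine mul_le_of_le_one_right hpy ?_
    rcases le_total (S y) B with hB | hB
    · have : Real.exp (s * (S y - B)) ≤ 1 := Real.exp_le_one_iff.2 (by nlinarith)
      nlinarith
    · have : 1 ≤ Real.exp (h * (S y - B)) := Real.one_le_exp (by nlinarith)
      nlinarith
  · have : 1 ≤ Real.exp (-(h * S y)) := Real.one_le_exp (by nlinarith)
    refine mul_nonpos_of_nonneg_of_nonpos hpy (mul_nonpos_of_nonneg_of_nonpos p1.le (by linarith))

/-- Without tilt no weight has to be undone, so only the lower tail is removed. -/
lemma le_sum_filter_nonneg_zero {κ : Type*} (A : Finset κ) {p S : κ → ℝ}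
    (hp : ∀ y ∈ A, 0 ≤ p y) {h : ℝ} (hh : 0 ≤ h) :
    (∑ y ∈ A, p y) - (∑ y ∈ A, p y * Real.exp (-h * S y)) ≤ ∑ y ∈ A with 0 ≤ S y, p y := by
  rw [Finset.sum_filter, ← Finset.sum_sub_distrib]
  refine Finset.sum_le_sum fun y hy => ?_
  have hpy := hp y hy
  split_ifs with h0
  · have := Real.exp_pos (-h * S y); nlinarith
  · have : 1 ≤ Real.exp (-h * S y) := Real.one_le_exp (by nlinarith)
    nlinarith

/-- A function with small second differences that grows at least linearly has, after few steps,
increments that are close to the prescribed slope. -/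
lemma exists_step_of_growth {φ : ℝ → ℝ} {h D e : ℝ} {N : ℕ}
    (hD : ∀ s, φ (s + h) + φ (s - h) - 2 * φ s ≤ D) (hN : 0 < N)
    (hφ : φ 0 + N * e ≤ φ (N * h)) :
    e - D ≤ φ 0 - φ (0 - h) ∨ ∃ k : ℕ, k ≤ N ∧ e ≤ φ (k * h) - φ (k * h - h) ∧
      φ (k * h + h) - φ (k * h) ≤ e + 2 * D := by
  have hex : ∃ k : ℕ, k < N ∧ e ≤ φ ((k + 1 : ℕ) * h) - φ (k * h) := by
    by_contra! hcon
    have : ∀ k : ℕ, k ≤ N → φ (k * h) ≤ φ 0 + k * e ∧ (0 < k → φ (k * h) < φ 0 + k * e) := by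
      intro k
      induction k with
      | zero => intro _; simp
      | succ k ih =>
        intro hk
        have h1 := (ih (by omega)).1
        have h2 := hcon k (by omega)
        push_cast at h2 ⊢
        exact ⟨by linarith, fun _ => by linarith⟩
    have := (this N le_rfl).2 hN
    linarith
  classical
  obtain ⟨hk, hk'⟩ := Nat.find_spec hex
  have hmin := fun j => Nat.find_min hex (m := j)
  generalize Nat.find hex = k at *
  rcases k with _ | k
  · left
    have := hD 0
    simp only [zero_add, Nat.cast_one, one_mul, Nat.cast_zero, zero_mul] at this hk'
    linarith
  · right
    have h1 := hmin k (by omega)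
    push Not at h1
    have h1 := h1 (by omega)
    -- Step k + 1 is the first with increment at least e, and k + 2 is its right end. The increment
    -- of step k is below e, and two second differences lead from it to the increment after k + 2.
    refine ⟨k + 2, by omega, ?_, ?_⟩
    · have : ((k + 2 : ℕ) : ℝ) * h - h = (k + 1 : ℕ) * h := by push_cast; ring
      rw [this]; exact hk'
    · have h2 := hD ((k + 1 : ℕ) * h)
      have h3 := hD ((k + 1 + 1 : ℕ) * h)
      have a1 : ((k + 1 : ℕ) : ℝ) * h + h = (k + 1 + 1 : ℕ) * h := by push_cast; ring
      have a2 : ((k + 1 : ℕ) : ℝ) * h - h = (k : ℕ) * h := by push_cast; ring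
      have a3 : ((k + 1 + 1 : ℕ) : ℝ) * h - h = (k + 1 : ℕ) * h := by push_cast; ring
      rw [a1, a2] at h2
      rw [a3] at h3
      show φ ((k + 1 + 1 : ℕ) * h + h) - φ ((k + 1 + 1 : ℕ) * h) ≤ _
      linarith

/-- A lower bound of Cramér type for the mass of the outcomes with nonnegative sum. -/
theorem exists_half_exp_le_sum_filter (T : ι → Finset Y) {w z : ι → Y → ℝ}
    (hw : ∀ i y, 0 ≤ w i y) {ρ : ℝ} (hz : ∀ i, ∀ y ∈ T i, |z i y| ≤ ρ) {φ : ℝ → ℝ}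
    (hφ : ∀ s, Real.exp (φ s) = ∏ i, ∑ y ∈ T i, w i y * Real.exp (s * z i y))
    {ε h : ℝ} {N : ℕ} (hh : 0 < h) (hN : 0 < N) (hρ : 8 * ρ ^ 2 * h ≤ ε)
    (hn : 3 ≤ Fintype.card ι * ε * h)
    (hgrow : φ 0 + N * (Fintype.card ι * ε * h) ≤ φ (N * h)) :
    ∃ s, 0 ≤ s ∧ s ≤ N * h ∧ Real.exp (φ s - 2 * Fintype.card ι * ε * s) / 2 ≤
      ∑ y ∈ Fintype.piFinset T with 0 ≤ ∑ i, z i (y i), ∏ i, w i (y i) := by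
  set n : ℝ := (Fintype.card ι : ℝ) with hn'
  have hn0 : 0 ≤ n := Nat.cast_nonneg _
  have hD : ∀ s, φ (s + h) + φ (s - h) - 2 * φ s ≤ n * ε * h / 4 := by
    intro s
    have h1 : Real.exp (φ (s + h) + φ (s - h)) ≤
        Real.exp (2 * φ s + n * (2 * ρ ^ 2 * h ^ 2)) := by
      rw [Real.exp_add, Real.exp_add, two_mul (φ s), Real.exp_add, hφ, hφ, hφ,
        ← Finset.prod_mul_distrib, ← Finset.prod_mul_distrib, hn', Real.exp_nat_mul,
        ← Finset.card_univ, ← Finset.prod_const, ← Finset.prod_mul_distrib]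
      refine Finset.prod_le_prod (fun i _ => ?_) fun i _ => ?_
      · exact mul_nonneg (Finset.sum_nonneg fun y _ => mul_nonneg (hw i y) (Real.exp_pos _).le)
          (Finset.sum_nonneg fun y _ => mul_nonneg (hw i y) (Real.exp_pos _).le)
      · rw [← sq]
        exact sum_mul_exp_mul_sum_mul_exp_le (hw i) (hz i) s h
    have h2 := Real.exp_le_exp.1 h1
    nlinarith [mul_le_mul_of_nonneg_left hρ (mul_nonneg hn0 hh.le)]
  have hp : ∀ y ∈ Fintype.piFinset T, 0 ≤ ∏ i, w i (y i) :=
    fun y _ => Finset.prod_nonneg fun i _ => hw i _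
  have hφ' : ∀ s, ∑ y ∈ Fintype.piFinset T, (∏ i, w i (y i)) * Real.exp (s * ∑ i, z i (y i)) =
      Real.exp (φ s) := fun s => by rw [hφ, prod_sum_mul_exp]
  have hquarter : ∀ x : ℝ, x ≤ -(3 / 2) → Real.exp x ≤ 1 / 4 := by
    intro x hx
    have h1 : 4 ≤ Real.exp (3 / 2) := by
      have := Real.exp_one_gt_d9
      have h2 : Real.exp (3 / 2) = Real.exp 1 * Real.exp (1 / 2) := by
        rw [← Real.exp_add]; norm_num
      have h3 : (1 / 2 : ℝ) + 1 ≤ Real.exp (1 / 2) := Real.add_one_le_exp _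
      rw [h2]; nlinarith
    calc Real.exp x ≤ Real.exp (-(3 / 2)) := Real.exp_le_exp.2 hx
      _ = (Real.exp (3 / 2))⁻¹ := Real.exp_neg _
      _ ≤ 1 / 4 := by rw [one_div]; exact inv_anti₀ (by norm_num) h1
  -- Here e = nεh and D = nεh/4. As nεh ≥ 3, each discarded tail has relative weight at most
  -- exp(-3/2) ≤ 1/4, so at least half of exp(φ s) survives.
  rcases exists_step_of_growth hD hN hgrow with h0 | ⟨k, hk, h1, h2⟩
  · refine ⟨0, le_rfl, by positivity, ?_⟩
    have h3 := le_sum_filter_nonneg_zero (Fintype.piFinset T) (S := fun y => ∑ i, z i (y i))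
      hp hh.le
    have h4 := hφ' 0
    simp only [zero_mul, Real.exp_zero, mul_one] at h4
    rw [h4, hφ'] at h3
    have h5 : Real.exp (φ (-h)) ≤ Real.exp (φ 0) * (1 / 4) := by
      calc Real.exp (φ (-h)) = Real.exp (φ 0) * Real.exp (φ (-h) - φ 0) := by
            rw [← Real.exp_add]; congr 1; ring
        _ ≤ _ := mul_le_mul_of_nonneg_left (hquarter _ (by rw [zero_sub] at h0; linarith))
            (Real.exp_pos _).le
    have h6 := Real.exp_pos (φ 0)
    rw [mul_zero, sub_zero]
    linarith
  · set s : ℝ := k * h with hs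
    have hs0 : 0 ≤ s := by positivity
    refine ⟨s, hs0, mul_le_mul_of_nonneg_right (by exact_mod_cast hk) hh.le, ?_⟩
    -- With B = 2nε the factor exp(-hB) outweighs the increment e + 2D = 3nεh/2 by nεh/2 ≥ 3/2.
    have h3 := le_sum_filter_nonneg (Fintype.piFinset T) (S := fun y => ∑ i, z i (y i)) hp
      (B := 2 * n * ε) hs0 hh.le
    rw [hφ', hφ', hφ'] at h3
    refine le_trans ?_ h3
    have h5 : Real.exp (φ (s - h)) ≤ Real.exp (φ s) * (1 / 4) := by
      calc Real.exp (φ (s - h)) = Real.exp (φ s) * Real.exp (φ (s - h) - φ s) := by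
            rw [← Real.exp_add]; congr 1; ring
        _ ≤ _ := mul_le_mul_of_nonneg_left (hquarter _ (by linarith)) (Real.exp_pos _).le
    have h6 : Real.exp (-(h * (2 * n * ε))) * Real.exp (φ (s + h)) ≤
        Real.exp (φ s) * (1 / 4) := by
      calc Real.exp (-(h * (2 * n * ε))) * Real.exp (φ (s + h)) =
          Real.exp (φ s) * Real.exp (φ (s + h) - φ s - 2 * (n * ε * h)) := by
            rw [← Real.exp_add, ← Real.exp_add]; congr 1; ring
        _ ≤ _ := mul_le_mul_of_nonneg_left (hquarter _ (by linarith)) (Real.exp_pos _).le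
    have h7 : Real.exp (φ s - 2 * n * ε * s) =
        Real.exp (-(s * (2 * n * ε))) * Real.exp (φ s) := by
      rw [← Real.exp_add]; congr 1; ring
    rw [h7, mul_div_assoc]
    refine mul_le_mul_of_nonneg_left ?_ (Real.exp_pos _).le
    linarith

end LargeDeviations

/-! ### Ramsey's theorem for pairs -/

section Ramsey

variable {κ : Type*} [Fintype κ]

/-- The usual first half of Ramsey's theorem: split off the least element, keep a majority colour
class of the pairs it forms, and recurse there. A pigeonhole on f then gives a monochromatic set. -/
lemma exists_endpoint_coloring (L : ℕ) : ∃ N : ℕ, ∀ (α : Type) [LinearOrder α] (col : α → α → κ)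
    (s : Finset α), N ≤ s.card → ∃ t ⊆ s, t.card = L ∧
      ∃ f : α → κ, ∀ i ∈ t, ∀ j ∈ t, i < j → col i j = f i := by
  classical
  induction L with
  | zero =>
    refine ⟨1, fun α _ col s hs => ⟨∅, Finset.empty_subset s, rfl, ?_⟩⟩
    obtain ⟨a, -⟩ := Finset.card_pos.1 hs
    exact ⟨fun i => col a i, by simp⟩
  | succ L ih =>
    obtain ⟨N, hN⟩ := ih
    refine ⟨Fintype.card κ * N + 1, fun α _ col s hs => ?_⟩
    have hne : s.Nonempty := Finset.card_pos.1 (by omega)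
    set m := s.min' hne
    have hm : m ∈ s := s.min'_mem hne
    have hcard : (Finset.univ : Finset κ).card * N ≤ (s.erase m).card := by
      rw [Finset.card_erase_of_mem hm, Finset.card_univ]; omega
    obtain ⟨c, -, hc⟩ := Finset.exists_le_card_fiber_of_mul_le_card_of_maps_to
      (f := fun j => col m j) (fun _ _ => Finset.mem_univ _) ⟨col m m, Finset.mem_univ _⟩ hcard
    obtain ⟨t, hts, htc, f, hf⟩ := hN α col _ hc
    have ht : ∀ j ∈ t, m < j ∧ j ∈ s ∧ col m j = c := by
      intro j hj
      have := Finset.mem_filter.1 (hts hj)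
      have h2 := Finset.mem_erase.1 this.1
      exact ⟨lt_of_le_of_ne (s.min'_le j h2.2) h2.1.symm, h2.2, this.2⟩
    have hmt : m ∉ t := fun h => lt_irrefl _ (ht m h).1
    refine ⟨insert m t, ?_, by rw [Finset.card_insert_of_notMem hmt, htc],
      Function.update f m c, ?_⟩
    · intro j hj
      rcases Finset.mem_insert.1 hj with rfl | hj
      · exact hm
      · exact (ht j hj).2.1
    · intro i hi j hj hij
      rcases Finset.mem_insert.1 hi with rfl | hi
      · rcases Finset.mem_insert.1 hj with rfl | hj
        · exact absurd hij (lt_irrefl _)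
        · rw [Function.update_self, (ht j hj).2.2]
      · have hmi := (ht i hi).1
        rw [Function.update_of_ne hmi.ne']
        rcases Finset.mem_insert.1 hj with rfl | hj
        · exact absurd hij hmi.not_gt
        · exact hf i hi j hj hij

/-- Ramsey's theorem for pairs and finitely many colours. -/
theorem exists_monochromatic_subset (K : ℕ) : ∃ N : ℕ, ∀ (α : Type) [LinearOrder α]
    (col : α → α → κ) (s : Finset α), N ≤ s.card → ∃ t ⊆ s, K ≤ t.card ∧
      ∃ c, ∀ i ∈ t, ∀ j ∈ t, i < j → col i j = c := by
  classical
  obtain ⟨N, hN⟩ := exists_endpoint_coloring (κ := κ) (Fintype.card κ * K)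
  -- The extra 1 makes s nonempty, which provides a colour for the pigeonhole principle.
  refine ⟨N + 1, fun α _ col s hs => ?_⟩
  obtain ⟨t, hts, htc, f, hf⟩ := hN α col s (by omega)
  obtain ⟨a, -⟩ := Finset.card_pos.1 (by omega : 0 < s.card)
  obtain ⟨c, -, hc⟩ := Finset.exists_le_card_fiber_of_mul_le_card_of_maps_to
    (s := t) (t := Finset.univ) (n := K) (f := f) (fun _ _ => Finset.mem_univ _)
    ⟨col a a, Finset.mem_univ _⟩ (by rw [htc, Finset.card_univ])
  refine ⟨_, (Finset.filter_subset _ _).trans hts, hc, c, fun i hi j hj hij => ?_⟩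
  simp only [Finset.mem_filter] at hi hj
  rw [hf i hi.1 j hj.1 hij, hi.2]

end Ramsey

/-! ### Pairs of sequences whose joint type is nearly a mixture of products -/

section JointTypes

variable {α : Type*} {n : ℕ}

/-- The normalized scalar product of two real sequences. -/
noncomputable def meanProd (f g : Fin n → ℝ) : ℝ := (∑ t, f t * g t) / n

/-- The average of the real sequences with index in `s`. -/
noncomputable def seqAvg (s : Finset α) (f : α → Fin n → ℝ) : Fin n → ℝ :=
  fun t => (∑ i ∈ s, f i t) / s.card

lemma meanProd_seqAvg (s s' : Finset α) (f g : α → Fin n → ℝ) :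
    meanProd (seqAvg s f) (seqAvg s' g) =
      (∑ i ∈ s, ∑ j ∈ s', meanProd (f i) (g j)) / (s.card * s'.card) := by
  have : ∑ i ∈ s, ∑ j ∈ s', meanProd (f i) (g j) =
      (∑ t, (∑ i ∈ s, f i t) * (∑ j ∈ s', g j t)) / n := by
    simp only [meanProd, ← Finset.sum_div, Finset.sum_mul_sum]
    congr 1
    rw [Finset.sum_comm]
    simp_rw [Finset.sum_comm (s := s) (t := (Finset.univ : Finset (Fin n)))]
    rw [Finset.sum_comm]
    refine Finset.sum_congr rfl fun t _ => ?_
    rw [Finset.sum_comm]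
  rw [this, meanProd, div_div, mul_comm (n : ℝ), ← div_div]
  congr 1
  rw [Finset.sum_div]
  refine Finset.sum_congr rfl fun t _ => ?_
  rw [seqAvg, seqAvg, div_mul_div_comm]

lemma abs_meanProd_seqAvg_sub_le {s s' : Finset α} (hs : s.Nonempty) (hs' : s'.Nonempty)
    {f g : α → Fin n → ℝ} {p δ : ℝ} (h : ∀ i ∈ s, ∀ j ∈ s', |meanProd (f i) (g j) - p| ≤ δ) :
    |meanProd (seqAvg s f) (seqAvg s' g) - p| ≤ δ := by
  have c1 : (0 : ℝ) < s.card := by exact_mod_cast hs.card_pos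
  have c2 : (0 : ℝ) < s'.card := by exact_mod_cast hs'.card_pos
  have e : meanProd (seqAvg s f) (seqAvg s' g) - p =
      (∑ i ∈ s, ∑ j ∈ s', (meanProd (f i) (g j) - p)) / (s.card * s'.card) := by
    rw [meanProd_seqAvg]
    simp only [Finset.sum_sub_distrib, Finset.sum_const, nsmul_eq_mul]
    field_simp
  rw [e, abs_div, abs_of_pos (mul_pos c1 c2), div_le_iff₀ (mul_pos c1 c2)]
  calc |∑ i ∈ s, ∑ j ∈ s', (meanProd (f i) (g j) - p)|
      ≤ ∑ i ∈ s, ∑ j ∈ s', |meanProd (f i) (g j) - p| :=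
        (Finset.abs_sum_le_sum_abs _ _).trans
          (Finset.sum_le_sum fun i _ => Finset.abs_sum_le_sum_abs _ _)
    _ ≤ ∑ i ∈ s, ∑ j ∈ s', δ :=
        Finset.sum_le_sum fun i hi => Finset.sum_le_sum fun j hj => h i hi j hj
    _ = δ * (s.card * s'.card) := by simp only [Finset.sum_const, nsmul_eq_mul]; ring

/-- The uncontrolled diagonal pairs i = j are a fraction 1 / `s.card` of all pairs, and each exceeds
the bound by at most 1. -/
lemma meanProd_seqAvg_self_le {s : Finset α} (hs : s.Nonempty) {f : α → Fin n → ℝ} {p δ : ℝ}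
    (h : ∀ i ∈ s, ∀ j ∈ s, i ≠ j → meanProd (f i) (f j) ≤ p + δ)
    (h1 : ∀ i ∈ s, meanProd (f i) (f i) ≤ p + δ + 1) :
    meanProd (seqAvg s f) (seqAvg s f) ≤ p + δ + 1 / s.card := by
  classical
  have c1 : (0 : ℝ) < s.card := by exact_mod_cast hs.card_pos
  rw [meanProd_seqAvg, div_le_iff₀ (mul_pos c1 c1)]
  calc ∑ i ∈ s, ∑ j ∈ s, meanProd (f i) (f j)
      ≤ ∑ i ∈ s, ∑ j ∈ s, (p + δ + if i = j then 1 else 0) := by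
        refine Finset.sum_le_sum fun i hi => Finset.sum_le_sum fun j hj => ?_
        split_ifs with hij
        · subst hij; exact h1 i hi
        · rw [add_zero]; exact h i hi j hj hij
    _ = ∑ i ∈ s, ((s.card : ℝ) * (p + δ) + 1) := by
        refine Finset.sum_congr rfl fun i hi => ?_
        rw [Finset.sum_add_distrib, Finset.sum_ite_eq, if_pos hi, Finset.sum_const, nsmul_eq_mul]
    _ = (p + δ + 1 / s.card) * (s.card * s.card) := by
        rw [Finset.sum_const, nsmul_eq_mul]; field_simp

lemma meanProd_comm (f g : Fin n → ℝ) : meanProd f g = meanProd g f := by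
  simp only [meanProd, mul_comm]

lemma meanProd_sub_right (f g g' : Fin n → ℝ) :
    meanProd f (g - g') = meanProd f g - meanProd f g' := by
  simp only [meanProd, Pi.sub_apply, mul_sub, Finset.sum_sub_distrib, sub_div]

lemma meanProd_sub_self (g g' : Fin n → ℝ) : meanProd (g - g') (g - g') =
    meanProd g g - 2 * meanProd g' g + meanProd g' g' := by
  rw [meanProd_sub_right, meanProd_comm, meanProd_sub_right, meanProd_comm (g - g') g',
    meanProd_sub_right, meanProd_comm g g']
  ring

/-- A substitute for Cauchy–Schwarz, from |g| ≤ c/2 + g²/(2c) at each position. -/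
lemma abs_meanProd_le (hn : 0 < n) {f g : Fin n → ℝ} (hf : ∀ t, |f t| ≤ 1) {c : ℝ} (hc : 0 < c) :
    |meanProd f g| ≤ c / 2 + meanProd g g / (2 * c) := by
  have hn' : (0 : ℝ) < n := by exact_mod_cast hn
  rw [meanProd, abs_div, abs_of_pos hn', div_le_iff₀ hn']
  have e : (c / 2 + meanProd g g / (2 * c)) * n = ∑ t, (c / 2 + g t * g t / (2 * c)) := by
    rw [Finset.sum_add_distrib, meanProd]
    simp only [← Finset.sum_div, Finset.sum_const, Finset.card_univ, Fintype.card_fin, nsmul_eq_mul]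
    field_simp
  rw [e]
  refine (Finset.abs_sum_le_sum_abs _ _).trans (Finset.sum_le_sum fun t _ => ?_)
  have h1 : |f t * g t| ≤ |g t| := by
    rw [abs_mul]; exact mul_le_of_le_one_left (abs_nonneg _) (hf t)
  refine h1.trans ?_
  rw [← abs_mul_abs_self (g t)]
  have : 0 ≤ (c - |g t|) ^ 2 / (2 * c) := by positivity
  have e2 : (c - |g t|) ^ 2 / (2 * c) = c / 2 + |g t| * |g t| / (2 * c) - |g t| := by
    field_simp; ring
  linarith

lemma exists_ordered_halves {α : Type*} [LinearOrder α] {t : Finset α} {L : ℕ}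
    (h : L + L ≤ t.card) : ∃ s s' : Finset α, s ⊆ t ∧ s' ⊆ t ∧ s.card = L ∧ s'.card = L ∧
      ∀ i ∈ s, ∀ j ∈ s', i < j := by
  obtain ⟨u, hut, hu⟩ := Finset.exists_subset_card_eq h
  let e := u.orderEmbOfFin hu
  refine ⟨Finset.univ.map ((Fin.castAddEmb L).trans e.toEmbedding),
    Finset.univ.map ((Fin.natAddEmb L).trans e.toEmbedding), ?_, ?_, by simp, by simp, ?_⟩
  · intro i hi
    obtain ⟨k, -, rfl⟩ := Finset.mem_map.1 hi
    exact hut (u.orderEmbOfFin_mem hu _)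
  · intro i hi
    obtain ⟨k, -, rfl⟩ := Finset.mem_map.1 hi
    exact hut (u.orderEmbOfFin_mem hu _)
  · intro i hi j hj
    obtain ⟨k, -, rfl⟩ := Finset.mem_map.1 hi
    obtain ⟨l, -, rfl⟩ := Finset.mem_map.1 hj
    refine e.strictMono ?_
    simp only [Fin.castAddEmb_apply, Fin.natAddEmb_apply, Fin.lt_def, Fin.val_castAdd,
      Fin.val_natAdd]
    omega

variable {X : Type*}

open Classical in
/-- The indicator sequence of the positions at which `x` has the letter `a`. -/
noncomputable def letterIndicator (a : X) (x : Fin n → X) : Fin n → ℝ :=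
  fun t => if x t = a then 1 else 0

/-- The joint type of two sequences. -/
noncomputable def jointType (x x' : Fin n → X) (a b : X) : ℝ :=
  meanProd (letterIndicator a x) (letterIndicator b x')

lemma jointType_comm (x x' : Fin n → X) (a b : X) : jointType x x' a b = jointType x' x b a :=
  meanProd_comm _ _

lemma letterIndicator_nonneg (a : X) (x : Fin n → X) (t : Fin n) : 0 ≤ letterIndicator a x t := by
  rw [letterIndicator]; split_ifs <;> norm_num

lemma letterIndicator_le_one (a : X) (x : Fin n → X) (t : Fin n) : letterIndicator a x t ≤ 1 := by
  rw [letterIndicator]; split_ifs <;> norm_num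

lemma jointType_nonneg (x x' : Fin n → X) (a b : X) : 0 ≤ jointType x x' a b :=
  div_nonneg (Finset.sum_nonneg fun _ _ => mul_nonneg (letterIndicator_nonneg _ _ _)
    (letterIndicator_nonneg _ _ _)) (Nat.cast_nonneg _)

lemma jointType_le_one (x x' : Fin n → X) (a b : X) : jointType x x' a b ≤ 1 := by
  refine div_le_one_of_le₀ ?_ (Nat.cast_nonneg _)
  calc _ ≤ ∑ _t : Fin n, (1 : ℝ) := Finset.sum_le_sum fun _ _ =>
        mul_le_one₀ (letterIndicator_le_one _ _ _) (letterIndicator_nonneg _ _ _)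
          (letterIndicator_le_one _ _ _)
    _ = n := by simp

lemma sum_eq_sum_jointType [Fintype X] (hn : 0 < n) (x x' : Fin n → X) (g : X → X → ℝ) :
    ∑ t, g (x t) (x' t) = n * ∑ a, ∑ b, jointType x x' a b * g a b := by
  classical
  have hn' : (n : ℝ) ≠ 0 := by positivity
  have : ∀ a b, (n : ℝ) * (jointType x x' a b * g a b) =
      ∑ t, letterIndicator a x t * letterIndicator b x' t * g a b := by
    intro a b
    rw [jointType, meanProd, ← Finset.sum_mul]
    field_simp
  simp_rw [Finset.mul_sum, this]
  simp_rw [Finset.sum_comm (t := (Finset.univ : Finset (Fin n)))]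
  refine Finset.sum_congr rfl fun t _ => ?_
  simp [letterIndicator]

/-- Among many sequences there are two whose joint type is nearly a mixture of product
distributions with equal factors. -/
theorem exists_jointType_near_mixture (X : Type*) [Fintype X] {Δ : ℝ} (hΔ : 0 < Δ) :
    ∃ N : ℕ, ∀ (α : Type) [LinearOrder α] (n : ℕ) (_ : 0 < n) (x : α → Fin n → X) (s : Finset α),
      N ≤ s.card → ∃ i ∈ s, ∃ j ∈ s, i ≠ j ∧ ∃ Q : Fin n → X → ℝ, (∀ t, Q t ∈ stdSimplex ℝ X) ∧
        ∀ a b, |jointType (x i) (x j) a b - (∑ t, Q t a * Q t b) / n| ≤ Δ := by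
  classical
  obtain ⟨δ, hδ, hδ1, hδ2⟩ : ∃ δ : ℝ, 0 < δ ∧ 2 * δ ≤ Δ / 4 ∧ 4 * δ ≤ Δ ^ 2 / 8 :=
    ⟨min (Δ / 8) (Δ ^ 2 / 32), by positivity, by linarith [min_le_left (Δ / 8) (Δ ^ 2 / 32)],
      by linarith [min_le_right (Δ / 8) (Δ ^ 2 / 32)]⟩
  obtain ⟨L, hL⟩ := exists_nat_gt (16 / Δ ^ 2)
  have hL0 : (0 : ℝ) < L := lt_of_le_of_lt (by positivity) hL
  have hL1 : 2 * (1 / (L : ℝ)) ≤ Δ ^ 2 / 8 := by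
    rw [mul_one_div, div_le_iff₀ hL0]
    rw [div_lt_iff₀ (by positivity)] at hL
    linarith
  -- A pair is coloured by its joint type rounded down to multiples of δ. The common value p need
  -- not be symmetric, because the colour refers to ordered pairs; two consecutive blocks of L
  -- indices serve to compare p with a symmetric form.
  obtain ⟨N, hN⟩ := exists_monochromatic_subset (κ := X → X → Fin (⌊1 / δ⌋₊ + 1)) (L + L)
  refine ⟨N, fun α _ n hn x s hs => ?_⟩
  obtain ⟨t, hts, ht, c, hc⟩ := hN α (fun i j a b =>
    ⟨⌊jointType (x i) (x j) a b / δ⌋₊, Nat.lt_succ_of_le (Nat.floor_le_floor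
      (div_le_div_of_nonneg_right (jointType_le_one _ _ _ _) hδ.le))⟩) s hs
  set p : X → X → ℝ := fun a b => δ * (c a b : ℕ) with hp
  have hclose : ∀ i ∈ t, ∀ j ∈ t, i < j → ∀ a b, |jointType (x i) (x j) a b - p a b| ≤ δ := by
    intro i hi j hj hij a b
    have h1 : ⌊jointType (x i) (x j) a b / δ⌋₊ = (c a b : ℕ) := by
      rw [← hc i hi j hj hij]
    have h2 := Nat.floor_le (div_nonneg (jointType_nonneg (x i) (x j) a b) hδ.le)
    have h3 := Nat.lt_floor_add_one (jointType (x i) (x j) a b / δ)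
    rw [h1] at h2 h3
    rw [le_div_iff₀ hδ] at h2
    rw [div_lt_iff₀ hδ] at h3
    rw [hp, abs_le]
    constructor <;> nlinarith
  obtain ⟨s1, s2, h1t, h2t, hc1, hc2, hlt⟩ := exists_ordered_halves ht
  have hLpos : 0 < L := by exact_mod_cast hL0
  have hne1 : s1.Nonempty := Finset.card_pos.1 (by omega)
  have hne2 : s2.Nonempty := Finset.card_pos.1 (by omega)
  obtain ⟨i, hi⟩ := hne1
  obtain ⟨j, hj⟩ := hne2
  have hne1 : s1.Nonempty := ⟨i, hi⟩
  have hne2 : s2.Nonempty := ⟨j, hj⟩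
  let U : Finset α → X → Fin n → ℝ := fun r a => seqAvg r fun k => letterIndicator a (x k)
  have hcard : (0 : ℝ) < s1.card := by rw [hc1]; exact hL0
  have hU0 : ∀ a k, 0 ≤ U s1 a k := fun a k =>
    div_nonneg (Finset.sum_nonneg fun l _ => letterIndicator_nonneg _ _ _) hcard.le
  have hU1 : ∀ k, ∑ a, U s1 a k = 1 := by
    intro k
    simp only [U, seqAvg]
    rw [← Finset.sum_div, Finset.sum_comm, div_eq_one_iff_eq hcard.ne']
    simp [letterIndicator]
  have hUle : ∀ a k, U s1 a k ≤ 1 := fun a k => by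
    rw [← hU1 k]
    exact Finset.single_le_sum (fun b _ => hU0 b k) (Finset.mem_univ a)
  have hself : ∀ r ⊆ t, r.card = L → ∀ b, meanProd (U r b) (U r b) ≤ p b b + δ + 1 / L := by
    intro r hr hrL b
    rw [← hrL]
    refine meanProd_seqAvg_self_le (Finset.card_pos.1 (by omega)) (fun k hk l hl hkl => ?_)
      fun k hk => ?_
    · rcases lt_or_gt_of_ne hkl with h | h
      · have := (abs_le.1 (hclose k (hr hk) l (hr hl) h b b)).2
        rw [jointType] at this; linarith
      · have := (abs_le.1 (hclose l (hr hl) k (hr hk) h b b)).2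
        rw [jointType, meanProd_comm] at this; linarith
    · have : jointType (x k) (x k) b b ≤ 1 := jointType_le_one _ _ _ _
      rw [jointType] at this
      have h0 : 0 ≤ p b b := by positivity
      linarith
  have hcross : ∀ a b, |meanProd (U s1 a) (U s2 b) - p a b| ≤ δ := fun a b =>
    abs_meanProd_seqAvg_sub_le hne1 hne2 fun k hk l hl =>
      hclose k (h1t hk) l (h2t hl) (hlt k hk l hl) a b
  refine ⟨i, hts (h1t hi), j, hts (h2t hj), (hlt i hi j hj).ne, fun k a => U s1 a k,
    fun k => ⟨fun a => hU0 a k, hU1 k⟩, fun a b => ?_⟩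
  have e1 := hclose i (h1t hi) j (h2t hj) (hlt i hi j hj) a b
  have e2 := hcross a b
  have e3 := abs_meanProd_le hn (f := U s1 a) (g := U s2 b - U s1 b)
    (fun k => abs_le.2 ⟨by linarith [hU0 a k], hUle a k⟩) (half_pos hΔ)
  -- Both squared norms are at most p(b,b) + δ + 1/L and the scalar product is at least p(b,b) - δ,
  -- so the block averages differ by at most 4δ + 2/L in squared norm. Hence the first block may
  -- replace the second, and its averages are the distributions Q t.
  have e4 : meanProd (U s2 b - U s1 b) (U s2 b - U s1 b) ≤ Δ ^ 2 / 4 := by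
    rw [meanProd_sub_self]
    have := hself s1 h1t hc1 b
    have := hself s2 h2t hc2 b
    have := (abs_le.1 (hcross b b)).1
    linarith
  have e5 : meanProd (U s2 b - U s1 b) (U s2 b - U s1 b) / (2 * (Δ / 2)) ≤ Δ / 4 := by
    rw [div_le_iff₀ (by positivity)]; nlinarith
  rw [meanProd_sub_right] at e3
  change |jointType (x i) (x j) a b - meanProd (U s1 a) (U s1 b)| ≤ Δ
  rw [abs_le] at e1 e2 e3 ⊢
  constructor <;> linarith

end JointTypes

/-! ### Quadratic forms on the simplex and attainment of the maximum -/

section QuadraticForms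

variable {X : Type*} [Fintype X]

lemma ereal_coe_sum {ι : Type*} (s : Finset ι) (f : ι → ℝ) :
    ((∑ i ∈ s, f i : ℝ) : EReal) = ∑ i ∈ s, (f i : EReal) := by
  classical
  induction s using Finset.induction_on with
  | empty => simp
  | insert a s ha ih => rw [Finset.sum_insert ha, Finset.sum_insert ha, EReal.coe_add, ih]

/-- The quadratic form `∑_{a,b} Q(a) Q(b) g(a,b)`. -/
def quadForm (g : X → X → ℝ) (Q : X → ℝ) : ℝ := ∑ a, ∑ b, Q a * Q b * g a b

lemma supForm_eq {f : X → X → ℝ → EReal} {g : X → X → ℝ → ℝ} (hf : ∀ a b s, f a b s = g a b s)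
    (Q : X → ℝ) :
    supForm f Q = ⨆ (s : ℝ) (_ : 0 ≤ s), ((quadForm (fun a b => g a b s) Q : ℝ) : EReal) := by
  simp only [supForm, quadForm, hf, ereal_coe_sum, EReal.coe_mul]

lemma quadForm_mono {g g' : X → X → ℝ} (h : ∀ a b, g a b ≤ g' a b) {Q : X → ℝ}
    (hQ : Q ∈ stdSimplex ℝ X) : quadForm g Q ≤ quadForm g' Q :=
  Finset.sum_le_sum fun a _ => Finset.sum_le_sum fun b _ =>
    mul_le_mul_of_nonneg_left (h a b) (mul_nonneg (hQ.1 a) (hQ.1 b))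

lemma quadForm_const (c : ℝ) {Q : X → ℝ} (hQ : Q ∈ stdSimplex ℝ X) :
    quadForm (fun _ _ => c) Q = c := by
  simp only [quadForm, ← Finset.sum_mul, ← Finset.mul_sum, hQ.2, one_mul]

lemma quadForm_add (g g' : X → X → ℝ) (Q : X → ℝ) :
    quadForm (fun a b => g a b + g' a b) Q = quadForm g Q + quadForm g' Q := by
  simp only [quadForm, mul_add, Finset.sum_add_distrib]

lemma quadForm_swap (g : X → X → ℝ) (Q : X → ℝ) :
    quadForm (fun a b => g b a) Q = quadForm g Q := by
  rw [quadForm, Finset.sum_comm]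
  simp only [quadForm, mul_comm (Q _) (Q _)]

lemma quadForm_eq_half (g : X → X → ℝ) (Q : X → ℝ) :
    quadForm g Q = quadForm (fun a b => g a b + g b a) Q / 2 := by
  rw [quadForm_add, quadForm_swap]; ring

lemma tendsto_quadForm {κ : Type*} {l : Filter κ} {g : κ → X → X → ℝ} {g₀ : X → X → ℝ}
    {Q : κ → X → ℝ} {Q₀ : X → ℝ} (hg : ∀ a b, Tendsto (fun k => g k a b) l (𝓝 (g₀ a b)))
    (hQ : Tendsto Q l (𝓝 Q₀)) : Tendsto (fun k => quadForm (g k) (Q k)) l (𝓝 (quadForm g₀ Q₀)) := by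
  rw [tendsto_pi_nhds] at hQ
  exact tendsto_finsetSum _ fun a _ => tendsto_finsetSum _ fun b _ =>
    ((hQ a).mul (hQ b)).mul (hg a b)

lemma quadForm_le_add_of_le (g : X → X → ℝ) {C : ℝ} (hg : ∀ a b, g a b ≤ C) {Q : X → ℝ}
    (hQ : Q ∈ stdSimplex ℝ X) (a₀ b₀ : X) :
    quadForm g Q ≤ C + Q a₀ * Q b₀ * (g a₀ b₀ - C) := by
  have h : quadForm (fun a b => C - g a b) Q = C - quadForm g Q := by
    have := quadForm_add (fun a b => C - g a b) g Q
    simp only [sub_add_cancel, quadForm_const C hQ] at this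
    linarith
  have h0 : ∀ a b, 0 ≤ Q a * Q b * (C - g a b) := fun a b =>
    mul_nonneg (mul_nonneg (hQ.1 a) (hQ.1 b)) (sub_nonneg.2 (hg a b))
  have h1 : Q a₀ * Q b₀ * (C - g a₀ b₀) ≤ quadForm (fun a b => C - g a b) Q :=
    (Finset.single_le_sum (f := fun b => Q a₀ * Q b * (C - g a₀ b)) (fun b _ => h0 a₀ b)
      (Finset.mem_univ b₀)).trans
      (Finset.single_le_sum (f := fun a => ∑ b, Q a * Q b * (C - g a b))
        (fun a _ => Finset.sum_nonneg fun b _ => h0 a b) (Finset.mem_univ a₀))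
  linarith

/-- The maximum over the simplex of `sup_{s ≥ 0} ∑ Q(a) Q(b) g_{a,b}(s)` is attained if the
symmetrized coefficients are bounded above and have limits in `[-∞, ∞)` as `s → ∞`. -/
theorem exists_isGreatest_supForm [Nonempty X] {f : X → X → ℝ → EReal} {g : X → X → ℝ → ℝ}
    (hf : ∀ a b s, f a b s = g a b s) (hc : ∀ a b, Continuous (g a b)) {C : ℝ}
    (hC : ∀ a b s, 0 ≤ s → g a b s + g b a s ≤ C)
    (hlim : ∀ a b, (∃ L, Tendsto (fun s => g a b s + g b a s) atTop (𝓝 L)) ∨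
      Tendsto (fun s => g a b s + g b a s) atTop atBot) :
    ∃ V : ℝ, IsGreatest (supForm f '' stdSimplex ℝ X) (V : EReal) := by
  classical
  set F : (X → ℝ) → ℝ → ℝ := fun Q s => quadForm (fun a b => g a b s) Q with hF
  have hFh : ∀ Q s, F Q s = quadForm (fun a b => g a b s + g b a s) Q / 2 := fun Q s =>
    quadForm_eq_half _ _
  set S : Set ℝ := (fun p : (X → ℝ) × ℝ => F p.1 p.2) '' (stdSimplex ℝ X ×ˢ Set.Ici 0) with hS
  have hSne : S.Nonempty := by
    obtain ⟨a⟩ := ‹Nonempty X›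
    exact ⟨_, (Pi.single a 1, 0), ⟨single_mem_stdSimplex ℝ a, Set.mem_Ici.2 le_rfl⟩, rfl⟩
  have hSb : BddAbove S := by
    refine ⟨C / 2, ?_⟩
    rintro _ ⟨⟨Q, s⟩, ⟨hQ, hs⟩, rfl⟩
    dsimp only
    rw [hFh, ← quadForm_const C hQ]
    exact div_le_div_of_nonneg_right (quadForm_mono (fun a b => hC a b s hs) hQ) two_pos.le
  set V := sSup S with hV
  have hle : ∀ Q ∈ stdSimplex ℝ X, supForm f Q ≤ V := fun Q hQ => by
    rw [supForm_eq hf]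
    exact iSup₂_le fun s hs => EReal.coe_le_coe_iff.2 (le_csSup hSb ⟨(Q, s), ⟨hQ, hs⟩, rfl⟩)
  have hge : ∀ Q s, 0 ≤ s → (F Q s : EReal) ≤ supForm f Q := fun Q s hs => by
    rw [supForm_eq hf]
    exact le_iSup₂ (f := fun s (_ : 0 ≤ s) => ((F Q s : ℝ) : EReal)) s hs
  suffices h : ∃ Q ∈ stdSimplex ℝ X, (V : EReal) ≤ supForm f Q by
    obtain ⟨Q, hQ, h⟩ := h
    exact ⟨V, ⟨Q, hQ, le_antisymm (hle Q hQ) h⟩, by rintro _ ⟨Q, hQ, rfl⟩; exact hle Q hQ⟩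
  obtain ⟨u, -, hu, huS⟩ := exists_seq_tendsto_sSup hSne hSb
  choose p hp hpu using huS
  -- Along an ultrafilter a maximizing sequence (Q, s) has a limit in Q by compactness, and s is
  -- either bounded, hence convergent, or tends to infinity.
  let 𝒰 : Ultrafilter ℕ := hyperfilter ℕ
  have h𝒰 : (𝒰 : Filter ℕ) ≤ atTop := by
    rw [← Nat.cofinite_eq_atTop]; exact hyperfilter_le_cofinite
  have hu' : Tendsto (fun k => F (p k).1 (p k).2) 𝒰 (𝓝 V) :=
    (hu.mono_left h𝒰).congr fun k => (hpu k).symm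
  obtain ⟨Q, hQ, hQl⟩ := isCompact_iff_ultrafilter_le_nhds.1 (isCompact_stdSimplex ℝ X)
    (𝒰.map fun k => (p k).1) (by
      rw [Filter.le_principal_iff]
      exact Filter.mem_map.2 (Filter.Eventually.of_forall fun k => (hp k).1))
  have hQl : Tendsto (fun k => (p k).1) 𝒰 (𝓝 Q) := hQl
  refine ⟨Q, hQ, ?_⟩
  by_cases hB : ∃ B, ∀ᶠ k in 𝒰, (p k).2 ≤ B
  · obtain ⟨B, hB⟩ := hB
    obtain ⟨s, hs, hsl⟩ := isCompact_iff_ultrafilter_le_nhds.1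
      (isCompact_Icc (a := (0 : ℝ)) (b := B))
      (𝒰.map fun k => (p k).2) (by
        rw [Filter.le_principal_iff]
        exact Filter.mem_map.2 (hB.mono fun k hk => ⟨(hp k).2, hk⟩))
    have hsl : Tendsto (fun k => (p k).2) 𝒰 (𝓝 s) := hsl
    have h1 : Tendsto (fun k => F (p k).1 (p k).2) 𝒰 (𝓝 (F Q s)) :=
      tendsto_quadForm (fun a b => ((hc a b).tendsto s).comp hsl) hQl
    rw [tendsto_nhds_unique hu' h1]
    exact hge Q s hs.1
  · have hs : Tendsto (fun k => (p k).2) 𝒰 atTop := by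
      refine tendsto_atTop.2 fun B => ?_
      have : ∀ᶠ k in 𝒰, ¬ (p k).2 ≤ B := Ultrafilter.eventually_not.2 fun h => hB ⟨B, h⟩
      exact this.mono fun k hk => (not_le.1 hk).le
    -- If the limit charged such a pair, the quadratic form would tend to -∞ along the maximizing
    -- sequence, since the other coefficients are at most C.
    have hzero : ∀ a b, Tendsto (fun s => g a b s + g b a s) atTop atBot → Q a * Q b = 0 := by
      intro a b hab
      by_contra hne
      have hpos : 0 < Q a * Q b := lt_of_le_of_ne (mul_nonneg (hQ.1 a) (hQ.1 b)) (Ne.symm hne)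
      have hQa := (tendsto_pi_nhds.1 hQl a).mul (tendsto_pi_nhds.1 hQl b)
      have h1 := (hQa.pos_mul_atBot hpos
        (tendsto_atBot_add_const_right _ (-C) (hab.comp hs)))
      have h2 := (tendsto_atBot_add_const_left _ C h1).atBot_div_const (two_pos : (0 : ℝ) < 2)
      refine not_tendsto_nhds_of_tendsto_atBot (tendsto_atBot_mono (fun k => ?_) h2) V hu'
      rw [hFh]
      exact div_le_div_of_nonneg_right (quadForm_le_add_of_le _
        (fun a b => hC a b _ (hp k).2) (hp k).1 a b) two_pos.le
    -- Coefficients tending to -∞ are replaced by the upper bound 0. This loses nothing in the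
    -- limit, where their weight is zero: the value for the fixed limit Q as s → ∞ equals the upper
    -- bound for V.
    have hk : ∀ a b, ∃ (κ : ℝ → ℝ) (ℓ : ℝ), Tendsto κ atTop (𝓝 ℓ) ∧
        (∀ᶠ s in atTop, g a b s + g b a s ≤ κ s) ∧
        Tendsto (fun s => Q a * Q b * (g a b s + g b a s)) atTop (𝓝 (Q a * Q b * ℓ)) := by
      intro a b
      rcases hlim a b with ⟨L, hL⟩ | h
      · exact ⟨_, L, hL, Eventually.of_forall fun _ => le_rfl, hL.const_mul _⟩
      · refine ⟨fun _ => 0, 0, tendsto_const_nhds, h.eventually_le_atBot 0, ?_⟩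
        simp [hzero a b h]
    choose κ ℓ hκ hle' hlow using hk
    have h1 : Tendsto (fun k => quadForm (fun a b => κ a b (p k).2) (p k).1 / 2) 𝒰
        (𝓝 (quadForm ℓ Q / 2)) :=
      (tendsto_quadForm (fun a b => (hκ a b).comp hs) hQl).div_const 2
    have hall : ∀ᶠ k in 𝒰, ∀ a b, g a b (p k).2 + g b a (p k).2 ≤ κ a b (p k).2 :=
      eventually_all.2 fun a => eventually_all.2 fun b => hs.eventually (hle' a b)
    have h2 : V ≤ quadForm ℓ Q / 2 := by
      refine le_of_tendsto_of_tendsto hu' h1 (hall.mono fun k hk => ?_)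
      dsimp only
      rw [hFh]
      exact div_le_div_of_nonneg_right (quadForm_mono hk (hp k).1) two_pos.le
    have h3 : Tendsto (fun s => F Q s) atTop (𝓝 (quadForm ℓ Q / 2)) := by
      simp only [hFh]
      exact (tendsto_finsetSum _ fun a _ => tendsto_finsetSum _ fun b _ => hlow a b).div_const 2
    refine (EReal.coe_le_coe_iff.2 h2).trans
      (le_of_tendsto (continuous_coe_real_ereal.continuousAt.tendsto.comp h3) ?_)
    filter_upwards [eventually_ge_atTop 0] with s hs0
    exact hge Q s hs0

end QuadraticForms

/-! ### The two exponents and their difference -/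

section Exponents

variable {X Y : Type*} [Fintype Y] {W : DMC X Y} {q : DecodingMetric W}

/-- After removal of the factor exp(s · `maxLogRatio`), only outputs of maximal log-ratio survive as
s → ∞; the others either decay or have probability zero. -/
lemma Confusable.tendsto_realMu_add (hq : Confusable q) {T : Finset Y} {a b : X}
    (hT : tightSupport q a b ⊆ T) (hT' : T ⊆ jointSupport q a b) :
    Tendsto (fun s => realMu q T a b s + s * maxLogRatio q a b) atTop
      (𝓝 (-Real.log (∑ y ∈ tightSupport q a b, W.prob a y))) := by
  classical
  have h1 : ∀ s, realMu q T a b s + s * maxLogRatio q a b = -Real.log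
      (∑ y ∈ T, W.prob a y * Real.exp (s * (logRatio q a b y - maxLogRatio q a b))) := by
    intro s
    have : ∑ y ∈ T, W.prob a y * Real.exp (s * (logRatio q a b y - maxLogRatio q a b)) =
        tiltedMass q T a b s * Real.exp (-(s * maxLogRatio q a b)) := by
      rw [tiltedMass, Finset.sum_mul]
      refine Finset.sum_congr rfl fun y _ => ?_
      rw [mul_assoc, ← Real.exp_add]; congr 2; ring
    rw [this, Real.log_mul (hq.tiltedMass_pos_of_subset hT s).ne' (Real.exp_pos _).ne',
      Real.log_exp, realMu]
    ring
  simp_rw [h1]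
  refine (Filter.Tendsto.log ?_ (hq.sum_tightSupport_pos a b).ne').neg
  have h2 : ∑ y ∈ tightSupport q a b, W.prob a y =
      ∑ y ∈ T, if y ∈ tightSupport q a b then W.prob a y else 0 := by
    rw [← Finset.sum_filter, Finset.filter_mem_eq_inter, Finset.inter_eq_right.2 hT]
  rw [h2]
  refine tendsto_finsetSum _ fun y hy => ?_
  split_ifs with hyt
  · rw [(hq.mem_tightSupport_iff.1 hyt).2]; simp
  · rcases (W.nonneg a y).eq_or_lt with hw | hw
    · simp [← hw]
    · have hlt : logRatio q a b y - maxLogRatio q a b < 0 := by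
        refine sub_neg.2 (lt_of_le_of_ne (hq.logRatio_le (hT' hy) hw) fun h => ?_)
        exact hyt (hq.mem_tightSupport_iff.2 ⟨hT' hy, h⟩)
      have h3 : Tendsto (fun s : ℝ => s * (logRatio q a b y - maxLogRatio q a b)) atTop atBot :=
        tendsto_id.atTop_mul_const_of_neg hlt
      simpa using (Real.tendsto_exp_atBot.comp h3).const_mul (W.prob a y)

theorem Confusable.exists_isGreatest_supForm_realMu [Fintype X] [Nonempty X] (hq : Confusable q)
    {T : X → X → Finset Y} (hT : ∀ a b, tightSupport q a b ⊆ T a b)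
    (hT' : ∀ a b, T a b ⊆ jointSupport q a b) {f : X → X → ℝ → EReal}
    (hf : ∀ a b s, f a b s = (realMu q (T a b) a b s : EReal)) :
    ∃ V : ℝ, IsGreatest (supForm f '' stdSimplex ℝ X) (V : EReal) := by
  set c : X → X → ℝ := fun a b => -Real.log (∑ y ∈ tightSupport q a b, W.prob a y)
  have hle : ∀ a b s, realMu q (T a b) a b s + realMu q (T b a) b a s ≤
      c a b + c b a - s * (maxLogRatio q a b + maxLogRatio q b a) := by
    intro a b s
    have h1 := hq.realMu_le (hT a b) s
    have h2 := hq.realMu_le (hT b a) s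
    simp only [c]; linarith
  obtain ⟨C, hC⟩ := Finite.bddAbove_range fun p : X × X => c p.1 p.2 + c p.2 p.1
  refine exists_isGreatest_supForm hf (fun a b => hq.continuous_realMu (hT a b)) (C := C)
    (fun a b s hs => ?_) fun a b => ?_
  · have h1 := hC ⟨(a, b), rfl⟩
    have h2 := mul_nonneg hs (hq.maxLogRatio_add_nonneg a b)
    have h3 := hle a b s
    dsimp only at h1
    linarith
  · rcases (hq.maxLogRatio_add_nonneg a b).eq_or_lt with h | h
    · refine Or.inl ⟨_, ((hq.tendsto_realMu_add (hT a b) (hT' a b)).add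
        (hq.tendsto_realMu_add (hT b a) (hT' b a))).congr fun s => ?_⟩
      linear_combination -s * h
    · refine Or.inr (tendsto_atBot_mono (hle a b) ?_)
      have := tendsto_atBot_add_const_left atTop (c a b + c b a)
        (tendsto_neg_atTop_atBot.comp (tendsto_id.atTop_mul_const h))
      simpa [Function.comp_def, sub_eq_add_neg] using this

/-- On 𝓑 both functions are trapped between lines of the same slope, so s cancels from their
difference; off 𝓑 the two supports coincide. The two orders are added because `gapTerm` combines
both letters. -/
lemma Confusable.realMu_hatSupport_sub_le (hq : Confusable q) {G : ℝ} (hG0 : 0 ≤ G)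
    (hG : ∀ p ∈ tightPairs q, gapTerm q p ≤ G) (a b : X) {s : ℝ} (hs : 0 ≤ s) :
    (realMu q (hatSupport q a b) a b s - realMu q (jointSupport q a b) a b s) +
      (realMu q (hatSupport q b a) b a s - realMu q (jointSupport q b a) b a s) ≤ G := by
  have key : ∀ a b, (a, b) ∈ tightPairs q →
      realMu q (hatSupport q a b) a b s - realMu q (jointSupport q a b) a b s ≤
        Real.log ((∑ y ∈ jointSupport q a b, W.prob a y) /
          ∑ y ∈ tightSupport q a b, W.prob a y) := by
    intro a b h
    have h1 := hq.realMu_le (tightSupport_subset_hatSupport q a b) s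
    have h2 := hq.le_realMu (tightSupport_subset_jointSupport q a b) subset_rfl hs
    have h3 := hq.tiltedMass_pos_of_subset (tightSupport_subset_jointSupport q a b) 0
    rw [tiltedMass_zero] at h3
    rw [Real.log_div h3.ne' (hq.sum_tightSupport_pos a b).ne']
    linarith
  by_cases h : (a, b) ∈ tightPairs q
  · refine le_trans ?_ (hG _ h)
    have h' := (hq.mem_tightPairs_comm a b).1 h
    have h1 := key a b h
    have h2 := key b a h'
    rw [← hq.tightSupport_comm h, jointSupport_comm q b a] at h2
    rw [jointSupport_comm q b a]
    exact add_le_add h1 h2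
  · have h' : (b, a) ∉ tightPairs q := fun h' => h ((hq.mem_tightPairs_comm a b).2 h')
    simp [hatSupport, h, h', hG0]

lemma Confusable.gapTerm_self (hq : Confusable q) (a : X) : 0 ≤ gapTerm q (a, a) := by
  have h := hq.sum_tightSupport_pos a a
  have h1 : 0 ≤ Real.log ((∑ y ∈ jointSupport q a a, W.prob a y) /
      ∑ y ∈ tightSupport q a a, W.prob a y) := by
    refine Real.log_nonneg ((one_le_div h).2 (Finset.sum_le_sum_of_subset_of_nonneg
      (tightSupport_subset_jointSupport q a a) fun y _ _ => W.nonneg a y))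
  exact add_nonneg h1 h1

lemma Confusable.realMu_jointSupport_le (hq : Confusable q) (a b : X) (s : ℝ) :
    realMu q (jointSupport q a b) a b s ≤ realMu q (hatSupport q a b) a b s :=
  neg_le_neg (Real.log_le_log (hq.tiltedMass_pos_of_subset (tightSupport_subset_hatSupport q a b) s)
    (tiltedMass_mono (hatSupport_subset_jointSupport q a b) a b s))

theorem Confusable.abs_sub_le_half_gap [Fintype X] [Nonempty X] (hq : Confusable q)
    {Eup Eex G : ℝ}
    (hup : IsGreatest (supForm (muHat q) '' stdSimplex ℝ X) (Eup : EReal))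
    (hex : IsGreatest (supForm (mu q) '' stdSimplex ℝ X) (Eex : EReal))
    (hG : IsGreatest (gapTerm q '' tightPairs q) G) : |Eup - Eex| ≤ G / 2 := by
  have hG0 : 0 ≤ G := by
    obtain ⟨a⟩ := ‹Nonempty X›
    exact (hq.gapTerm_self a).trans (hG.2 ⟨_, hq.self_mem_tightPairs a, rfl⟩)
  have h1 : Eex ≤ Eup := by
    obtain ⟨Q, hQ, h⟩ := hex.1
    rw [← EReal.coe_le_coe_iff, ← h]
    refine le_trans ?_ (hup.2 ⟨Q, hQ, rfl⟩)
    rw [supForm_eq hq.mu_eq, supForm_eq hq.muHat_eq]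
    exact iSup₂_mono fun s _ => EReal.coe_le_coe_iff.2
      (quadForm_mono (fun a b => hq.realMu_jointSupport_le a b s) hQ)
  have h2 : Eup ≤ Eex + G / 2 := by
    obtain ⟨Q, hQ, h⟩ := hup.1
    rw [← EReal.coe_le_coe_iff, ← h, supForm_eq hq.muHat_eq]
    refine iSup₂_le fun s hs => EReal.coe_le_coe_iff.2 ?_
    have h3 : quadForm (fun a b => realMu q (jointSupport q a b) a b s) Q ≤ Eex := by
      rw [← EReal.coe_le_coe_iff]
      refine le_trans ?_ (hex.2 ⟨Q, hQ, rfl⟩)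
      rw [supForm_eq hq.mu_eq]
      exact le_iSup₂ (f := fun s (_ : 0 ≤ s) =>
        ((quadForm (fun a b => realMu q (jointSupport q a b) a b s) Q : ℝ) : EReal)) s hs
    have h4 : quadForm (fun a b => realMu q (hatSupport q a b) a b s -
        realMu q (jointSupport q a b) a b s) Q ≤ G / 2 := by
      rw [quadForm_eq_half, ← quadForm_const G hQ]
      refine div_le_div_of_nonneg_right (quadForm_mono (fun a b => ?_) hQ) two_pos.le
      exact hq.realMu_hatSupport_sub_le hG0 (fun p hp => hG.2 ⟨p, hp, rfl⟩) a b hs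
    have h5 := quadForm_add (fun a b => realMu q (hatSupport q a b) a b s -
        realMu q (jointSupport q a b) a b s) (fun a b => realMu q (jointSupport q a b) a b s) Q
    simp only [sub_add_cancel] at h5
    linarith
  rw [abs_le]; constructor <;> linarith

end Exponents

/-! ### Error probability of codes -/

section Codes

variable {X Y : Type*} [Fintype Y] {W : DMC X Y} {q : DecodingMetric W}

lemma blockProb_nonneg (W : DMC X Y) {n : ℕ} (x : Fin n → X) (y : Fin n → Y) :
    0 ≤ blockProb W x y := Finset.prod_nonneg fun _ _ => W.nonneg _ _

lemma decodeProb_le_one (q : DecodingMetric W) {M n : ℕ} (c : Fin M → Fin n → X) (y : Fin n → Y)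
    (m : Fin M) : decodeProb q c y m ≤ 1 := by
  rw [decodeProb]
  split_ifs with h
  · have : (1 : ℝ) ≤ (bestMessages q c y).card := by
      exact_mod_cast Finset.card_pos.2 ⟨m, h⟩
    exact div_le_one_of_le₀ this (by positivity)
  · exact zero_le_one

lemma errorProb_nonneg (q : DecodingMetric W) {M n : ℕ} (c : Fin M → Fin n → X) (m : Fin M) :
    0 ≤ errorProb q c m :=
  Finset.sum_nonneg fun y _ => mul_nonneg (blockProb_nonneg W _ _)
    (sub_nonneg.2 (decodeProb_le_one q c y m))

lemma mem_bestMessages {M n : ℕ} {c : Fin M → Fin n → X} {y : Fin n → Y} {m : Fin M} :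
    m ∈ bestMessages q c y ↔ ∀ m', blockMetric q (c m') y ≤ blockMetric q (c m) y := by
  simp [bestMessages]

lemma decodeProb_le_half {M n : ℕ} {c : Fin M → Fin n → X} {y : Fin n → Y} {m m' : Fin M}
    (hne : m ≠ m') (h : blockMetric q (c m) y ≤ blockMetric q (c m') y) :
    decodeProb q c y m ≤ 1 / 2 := by
  classical
  rw [decodeProb]
  split_ifs with hm
  · have hm' : m' ∈ bestMessages q c y :=
      mem_bestMessages.2 fun k => (mem_bestMessages.1 hm k).trans h
    have h2 : 2 ≤ (bestMessages q c y).card := by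
      rw [← Finset.card_pair hne]
      exact Finset.card_le_card (by
        intro k hk
        rcases Finset.mem_insert.1 hk with rfl | hk
        · exact hm
        · rwa [Finset.mem_singleton.1 hk])
    exact one_div_le_one_div_of_le two_pos (by exact_mod_cast h2)
  · norm_num

lemma decodeProb_eq_one {M n : ℕ} {c : Fin M → Fin n → X} {y : Fin n → Y} {m : Fin M}
    (h : ∀ m', m' ≠ m → blockMetric q (c m') y < blockMetric q (c m) y) :
    decodeProb q c y m = 1 := by
  have hb : bestMessages q c y = {m} := by
    ext k
    rw [mem_bestMessages, Finset.mem_singleton]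
    constructor
    · intro hk
      by_contra hne
      exact (h k hne).not_ge (hk m)
    · rintro rfl l
      by_cases hl : l = k
      · rw [hl]
      · exact (h _ hl).le
  simp [decodeProb, hb]

lemma zero_lt_of_blockProb_ne_zero {n : ℕ} {x : Fin n → X} {y : Fin n → Y}
    (h : blockProb W x y ≠ 0) (i : Fin n) : 0 < W.prob (x i) (y i) :=
  lt_of_le_of_ne (W.nonneg _ _) (Ne.symm (Finset.prod_ne_zero_iff.1 h i (Finset.mem_univ i)))

lemma val_mul_lt_of_maxRatio_lt {a b : X} (h : maxRatio q a b < minRatio q a b) {y z : Y}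
    (hy : 0 < W.prob a y) (hz : 0 < W.prob b z) :
    q.val a z * q.val b y < q.val a y * q.val b z := by
  have h1 : ratio q a b z < ratio q a b y :=
    lt_of_le_of_lt (le_iSup₂ (f := fun y (_ : 0 < W.prob b y) => ratio q a b y) z hz)
      (lt_of_lt_of_le h (iInf₂_le y hy))
  have hay := q.pos_of_prob_pos a y hy
  have hbz := q.pos_of_prob_pos b z hz
  rcases (q.nonneg b y).eq_or_lt with h0 | h0
  · rw [← h0, mul_zero]; positivity
  · rw [ratio_eq_ofReal hbz, ratio_eq_ofReal h0,
      ENNReal.ofReal_lt_ofReal_iff (by positivity), div_lt_div_iff₀ hbz h0] at h1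
    exact h1

/-- If every ratio possible under a exceeds every ratio possible under b, the codewords ab and ba
are separated strictly by the product metric, giving a code of positive rate without error. -/
lemma confusable_of_zeroErrorCapacity_eq_zero (hC : zeroErrorCapacity q = 0) : Confusable q := by
  intro a b
  by_contra! h
  let c : Fin 2 → Fin 2 → X := ![![a, b], ![b, a]]
  have herr : ∀ m, errorProb q c m = 0 := by
    intro m
    refine Finset.sum_eq_zero fun y _ => ?_
    by_cases hy : blockProb W (c m) y = 0
    · rw [hy, zero_mul]
    · have hpos := zero_lt_of_blockProb_ne_zero hy
      rw [decodeProb_eq_one, sub_self, mul_zero]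
      intro m' hm'
      simp only [blockMetric, Fin.prod_univ_two]
      have h0 := hpos 0
      have h1 := hpos 1
      fin_cases m <;> fin_cases m' <;> simp [c] at hm' h0 h1 ⊢
      · have := val_mul_lt_of_maxRatio_lt h h0 h1
        linarith
      · have := val_mul_lt_of_maxRatio_lt h h1 h0
        linarith
  have havg : avgErrorProb q c = 0 := by simp [avgErrorProb, herr]
  have hle : ((rate 2 2 : ℝ) : EReal) ≤ zeroErrorCapacity q :=
    le_iSup_of_le 2 (le_iSup_of_le 2 (le_iSup_of_le c
      (le_iSup_of_le ⟨two_pos, two_pos, havg⟩ le_rfl)))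
  rw [hC, ← EReal.coe_zero, EReal.coe_le_coe_iff] at hle
  have : 0 < rate 2 2 := div_pos (Real.log_pos (by norm_num)) (by norm_num)
  linarith

/-- The probability, when `x` is sent, that the metric of `x'` is at least that of `x`. -/
noncomputable def pairError (q : DecodingMetric W) {n : ℕ} (x x' : Fin n → X) : ℝ :=
  ∑ y with blockMetric q x y ≤ blockMetric q x' y, blockProb W x y

lemma pairError_le_errorProb {M n : ℕ} (c : Fin M → Fin n → X) {m m' : Fin M} (hne : m ≠ m') :
    pairError q (c m) (c m') / 2 ≤ errorProb q c m := by
  rw [pairError, errorProb, Finset.sum_filter, Finset.sum_div]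
  refine Finset.sum_le_sum fun y _ => ?_
  have h0 := blockProb_nonneg W (c m) y
  split_ifs with h
  · have := decodeProb_le_half hne h
    nlinarith
  · rw [zero_div]
    exact mul_nonneg h0 (sub_nonneg.2 (decodeProb_le_one q c y m))

lemma sum_piFinset_le_pairError {n : ℕ} {x x' : Fin n → X} {T : Fin n → Finset Y}
    (hT : ∀ i, T i ⊆ jointSupport q (x i) (x' i)) :
    ∑ y ∈ Fintype.piFinset T with 0 ≤ ∑ i, logRatio q (x i) (x' i) (y i),
      ∏ i, W.prob (x i) (y i) ≤ pairError q x x' := by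
  refine Finset.sum_le_sum_of_subset_of_nonneg (fun y hy => ?_)
    fun y _ _ => blockProb_nonneg W x y
  obtain ⟨hyT, hy⟩ := Finset.mem_filter.1 hy
  have hpos := fun i => mem_jointSupport.1 (hT i (Fintype.mem_piFinset.1 hyT i))
  refine Finset.mem_filter.2 ⟨Finset.mem_univ _, ?_⟩
  have h1 : 0 < blockMetric q x y := Finset.prod_pos fun i _ => (hpos i).1
  have h3 : 0 < blockMetric q x' y := Finset.prod_pos fun i _ => (hpos i).2
  have h2 : ∏ i, (q.val (x' i) (y i) / q.val (x i) (y i)) =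
      blockMetric q x' y / blockMetric q x y := Finset.prod_div_distrib ..
  simp only [logRatio] at hy
  rw [← Real.log_prod fun i _ => (div_pos (hpos i).2 (hpos i).1).ne', h2,
    Real.log_nonneg_iff (div_pos h3 h1), one_le_div h1] at hy
  exact hy

/-- On the product of the tight supports the total log-ratio is constant, equal to the sum in the
hypothesis, so all of this mass counts as error. -/
lemma Confusable.prod_tightSupport_le_pairError (hq : Confusable q) {n : ℕ} {x x' : Fin n → X}
    (h : 0 ≤ ∑ i, maxLogRatio q (x i) (x' i)) :
    ∏ i, ∑ y ∈ tightSupport q (x i) (x' i), W.prob (x i) y ≤ pairError q x x' := by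
  refine le_trans (le_of_eq ?_) (sum_piFinset_le_pairError (q := q) (x := x) (x' := x')
    fun i => tightSupport_subset_jointSupport q (x i) (x' i))
  rw [Finset.prod_univ_sum, Finset.filter_true_of_mem]
  intro y hy
  rw [Finset.sum_congr rfl fun i _ =>
    (hq.mem_tightSupport_iff.1 (Fintype.mem_piFinset.1 hy i)).2]
  exact h

lemma Confusable.exp_neg_sum_realMu (hq : Confusable q) {n : ℕ} (x x' : Fin n → X)
    {T : Fin n → Finset Y} (hT : ∀ i, tightSupport q (x i) (x' i) ⊆ T i) (s : ℝ) :
    Real.exp (-∑ i, realMu q (T i) (x i) (x' i) s) =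
      ∏ i, ∑ y ∈ T i, W.prob (x i) y * Real.exp (s * logRatio q (x i) (x' i) y) := by
  rw [← Finset.sum_neg_distrib, Real.exp_sum]
  refine Finset.prod_congr rfl fun i _ => ?_
  rw [realMu, neg_neg, Real.exp_log (hq.tiltedMass_pos_of_subset (hT i) s), tiltedMass]

/-- On 𝓑 there is nothing to lose, as `hatSupport` is already tight. Off 𝓑 the gap is positive, and
there are finitely many pairs, so a multiple of the gap pays for the restriction to tight outputs.
-/
lemma Confusable.exists_loss_le [Finite X] (hq : Confusable q) : ∃ C : ℝ, 0 ≤ C ∧ ∀ a b : X,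
    -Real.log (∑ y ∈ tightSupport q a b, W.prob a y) ≤ realMu q (hatSupport q a b) a b 0 +
      C * (maxLogRatio q a b + maxLogRatio q b a) := by
  have key : ∀ p : X × X, ∃ C : ℝ, 0 ≤ C ∧
      -Real.log (∑ y ∈ tightSupport q p.1 p.2, W.prob p.1 y) ≤
        realMu q (hatSupport q p.1 p.2) p.1 p.2 0 +
          C * (maxLogRatio q p.1 p.2 + maxLogRatio q p.2 p.1) := by
    rintro ⟨a, b⟩
    by_cases h : (a, b) ∈ tightPairs q
    · refine ⟨0, le_rfl, ?_⟩
      simp only [hatSupport, h, if_true, hq.realMu_tightSupport]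
      simp
    · have hpos : 0 < maxLogRatio q a b + maxLogRatio q b a :=
        lt_of_le_of_ne (hq.maxLogRatio_add_nonneg a b)
          fun h0 => h ((hq.mem_tightPairs_iff a b).2 h0.symm)
      have h1 : 0 ≤ -Real.log (∑ y ∈ tightSupport q a b, W.prob a y) :=
        neg_nonneg.2 (Real.log_nonpos (hq.sum_tightSupport_pos a b).le (sum_prob_le_one W _ a))
      refine ⟨_, div_nonneg h1 hpos.le, ?_⟩
      rw [div_mul_cancel₀ _ hpos.ne']
      linarith [hq.realMu_zero_nonneg (tightSupport_subset_hatSupport q a b)]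
  choose C hC0 hC using key
  obtain ⟨B, hB⟩ := Finite.bddAbove_range C
  refine ⟨max B 0, le_max_right _ _, fun a b => (hC (a, b)).trans ?_⟩
  have := mul_le_mul_of_nonneg_right ((hB ⟨(a, b), rfl⟩).trans (le_max_left B 0))
    (hq.maxLogRatio_add_nonneg a b)
  simpa using this

/-- A lower bound for the error probability of a pair of long sequences that are favourably
ordered. -/
theorem Confusable.exists_exp_le_pairError_of_ordered [Finite X] (hq : Confusable q) {θ : ℝ}
    (hθ : 0 < θ) : ∃ S : ℝ, 0 ≤ S ∧ ∃ n₀ : ℕ, ∀ n, n₀ ≤ n → ∀ (x x' : Fin n → X) (E : ℝ),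
      (∀ s, 0 ≤ s → s ≤ S →
        ∑ i, realMu q (hatSupport q (x i) (x' i)) (x i) (x' i) s ≤ n * E) →
      ∑ i, (maxLogRatio q (x i) (x' i) + maxLogRatio q (x' i) (x i)) ≤
        2 * ∑ i, maxLogRatio q (x i) (x' i) →
      Real.exp (-(n * (E + θ))) ≤ pairError q x x' := by
  obtain ⟨C', hC'0, hC'⟩ := hq.exists_loss_le
  obtain ⟨C₁, hC₁⟩ := Finite.bddAbove_range fun p : X × X =>
    -Real.log (∑ y ∈ tightSupport q p.1 p.2, W.prob p.1 y)
  obtain ⟨ρ, hρ⟩ := Finite.bddAbove_range fun p : X × X × Y => |logRatio q p.1 p.2.1 p.2.2|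
  obtain ⟨C, hC0, hC⟩ : ∃ C : ℝ, 0 ≤ C ∧ ∀ a b : X,
      -Real.log (∑ y ∈ tightSupport q a b, W.prob a y) ≤ C :=
    ⟨max C₁ 0, le_max_right _ _, fun a b => (hC₁ ⟨(a, b), rfl⟩).trans (le_max_left _ _)⟩
  -- η separates the regimes: for k ≤ ηn the loss C'k stays below nθ. For k > ηn, S makes the growth
  -- Sk/2 - nC at least nSη/4 ≥ nεS, while ε ≤ θ/(4S) keeps the Cramér loss 2nεs below nθ/2. None of
  -- these constants depends on n or on the sequences.
  set η : ℝ := θ / (C' + 1) with hη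
  have hη0 : 0 < η := by positivity
  have hηθ : C' * η ≤ θ := by
    rw [hη, mul_div_assoc', div_le_iff₀ (by positivity)]; nlinarith
  set S : ℝ := 4 * C / η + 1 with hS
  have hS0 : 0 < S := by positivity
  have hSC : C ≤ S * η / 4 := by
    rw [hS]; field_simp; linarith
  set ε : ℝ := min (η / 4) (θ / (4 * S)) with hε
  have hε0 : 0 < ε := by positivity
  have hε1 : ε ≤ η / 4 := min_le_left _ _
  have hε2 : ε * S ≤ θ / 4 := by
    have : ε ≤ θ / (4 * S) := min_le_right _ _
    rw [le_div_iff₀ (by positivity)] at this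
    linarith
  obtain ⟨N, hN⟩ := exists_nat_gt (8 * ρ ^ 2 * S / ε)
  have hN0 : (0 : ℝ) < N := lt_of_le_of_lt (by positivity) hN
  set h : ℝ := S / N with hh
  have hh0 : 0 < h := by positivity
  have hNh : N * h = S := by rw [hh]; field_simp
  have hρh : 8 * ρ ^ 2 * h ≤ ε := by
    rw [div_lt_iff₀ hε0] at hN
    rw [hh, mul_div_assoc', div_le_iff₀ hN0]
    linarith
  obtain ⟨n₁, hn₁⟩ := exists_nat_ge (3 / (ε * h))
  obtain ⟨n₂, hn₂⟩ := exists_nat_ge (2 / θ)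
  refine ⟨S, hS0.le, max n₁ n₂, fun n hn x x' E hE hord => ?_⟩
  have hn1 : 3 ≤ n * ε * h := by
    have h1 : (n₁ : ℝ) ≤ n := by exact_mod_cast (le_max_left _ _).trans hn
    have h2 := hn₁.trans h1
    rw [div_le_iff₀ (by positivity)] at h2
    linarith
  have hn2 : 2 ≤ n * θ := by
    have h1 : (n₂ : ℝ) ≤ n := by exact_mod_cast (le_max_right _ _).trans hn
    have h2 := hn₂.trans h1
    rwa [div_le_iff₀ hθ] at h2
  have hn0 : (0 : ℝ) ≤ n := Nat.cast_nonneg n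
  set k : ℝ := ∑ i, (maxLogRatio q (x i) (x' i) + maxLogRatio q (x' i) (x i)) with hk
  have hk0 : 0 ≤ k := Finset.sum_nonneg fun i _ => hq.maxLogRatio_add_nonneg _ _
  rcases le_or_gt k (η * n) with hkn | hkn
  · refine le_trans ?_ (hq.prod_tightSupport_le_pairError (by linarith))
    have e : ∏ i, ∑ y ∈ tightSupport q (x i) (x' i), W.prob (x i) y =
        Real.exp (-∑ i, -Real.log (∑ y ∈ tightSupport q (x i) (x' i), W.prob (x i) y)) := by
      rw [Finset.sum_neg_distrib, neg_neg, Real.exp_sum]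
      exact Finset.prod_congr rfl fun i _ => (Real.exp_log (hq.sum_tightSupport_pos _ _)).symm
    rw [e]
    refine Real.exp_le_exp.2 (neg_le_neg ?_)
    calc ∑ i, -Real.log (∑ y ∈ tightSupport q (x i) (x' i), W.prob (x i) y)
        ≤ ∑ i, (realMu q (hatSupport q (x i) (x' i)) (x i) (x' i) 0 +
            C' * (maxLogRatio q (x i) (x' i) + maxLogRatio q (x' i) (x i))) :=
          Finset.sum_le_sum fun i _ => hC' _ _
      _ = ∑ i, realMu q (hatSupport q (x i) (x' i)) (x i) (x' i) 0 + C' * k := by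
          rw [Finset.sum_add_distrib, ← Finset.mul_sum]
      _ ≤ n * E + C' * (η * n) :=
          add_le_add (hE 0 le_rfl hS0.le) (mul_le_mul_of_nonneg_left hkn hC'0)
      _ ≤ n * (E + θ) := by nlinarith
  · set φ : ℝ → ℝ := fun s => -∑ i, realMu q (hatSupport q (x i) (x' i)) (x i) (x' i) s with hφ
    have hφ0 : φ 0 ≤ 0 := neg_nonpos.2 (Finset.sum_nonneg fun i _ =>
      hq.realMu_zero_nonneg (tightSupport_subset_hatSupport q _ _))
    -- This is where the favourable order is used: the total slope ∑ `maxLogRatio` is at least k/2.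
    have hφS : S * (k / 2) - n * C ≤ φ S := by
      have h1 : ∑ i, realMu q (hatSupport q (x i) (x' i)) (x i) (x' i) S ≤
          ∑ i, (C - S * maxLogRatio q (x i) (x' i)) := Finset.sum_le_sum fun i _ =>
        (hq.realMu_le (tightSupport_subset_hatSupport q _ _) S).trans
          (sub_le_sub_right (hC _ _) _)
      rw [Finset.sum_sub_distrib, ← Finset.mul_sum, Finset.sum_const, Finset.card_univ,
        Fintype.card_fin, nsmul_eq_mul] at h1
      have h2 := mul_le_mul_of_nonneg_left hord hS0.le
      simp only [hφ]
      linarith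
    have hgrow : φ 0 + N * (Fintype.card (Fin n) * ε * h) ≤ φ (N * h) := by
      have e1 : (N : ℝ) * (n * ε * h) = n * (ε * S) := by rw [← hNh]; ring
      rw [hNh, Fintype.card_fin, e1]
      have h3 : n * (ε * S) ≤ n * (η / 4 * S) :=
        mul_le_mul_of_nonneg_left (mul_le_mul_of_nonneg_right hε1 hS0.le) hn0
      have h4 : n * C ≤ n * (S * η / 4) := mul_le_mul_of_nonneg_left hSC hn0
      have h5 : S * (η * n / 2) ≤ S * (k / 2) :=
        mul_le_mul_of_nonneg_left (by linarith) hS0.le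
      linarith
    obtain ⟨s, hs0, hs1, hs2⟩ := exists_half_exp_le_sum_filter
      (fun i => hatSupport q (x i) (x' i)) (w := fun i y => W.prob (x i) y)
      (z := fun i y => logRatio q (x i) (x' i) y) (fun i y => W.nonneg _ _) (ρ := ρ)
      (fun i y _ => hρ ⟨(x i, x' i, y), rfl⟩) (φ := φ)
      (fun s => hq.exp_neg_sum_realMu x x' (fun i => tightSupport_subset_hatSupport q _ _) s)
      hh0 (by exact_mod_cast hN0) hρh (by rw [Fintype.card_fin]; exact hn1) hgrow
    refine le_trans ?_ (hs2.trans (sum_piFinset_le_pairError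
      fun i => hatSupport_subset_jointSupport q _ _))
    rw [hNh] at hs1
    have h6 : Real.exp (-1) ≤ 1 / 2 := by
      rw [Real.exp_neg, one_div]
      exact inv_anti₀ two_pos (by have := Real.add_one_le_exp 1; linarith)
    rw [Fintype.card_fin]
    have h7 : -(n * (E + θ)) ≤ (φ s - 2 * n * ε * s) + -1 := by
      have h8 := hE s hs0 hs1
      have h9 : n * (ε * s) ≤ n * (θ / 4) := mul_le_mul_of_nonneg_left
        ((mul_le_mul_of_nonneg_left hs1 hε0.le).trans hε2) hn0
      simp only [hφ]
      linarith
    calc Real.exp (-(n * (E + θ))) ≤ Real.exp ((φ s - 2 * n * ε * s) + -1) := Real.exp_le_exp.2 h7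
      _ = Real.exp (φ s - 2 * n * ε * s) * Real.exp (-1) := Real.exp_add _ _
      _ ≤ Real.exp (φ s - 2 * n * ε * s) * (1 / 2) :=
          mul_le_mul_of_nonneg_left h6 (Real.exp_pos _).le
      _ = _ := by ring

/-- Markov's inequality. Working inside this half turns the average error into a bound for each
message of the pair found later. -/
lemma card_le_two_mul_card_errorProb_le {M n : ℕ} (q : DecodingMetric W) (c : Fin M → Fin n → X) :
    M ≤ 2 * (Finset.univ.filter fun m => errorProb q c m ≤ 2 * avgErrorProb q c).card := by
  classical
  rcases Nat.eq_zero_or_pos M with hM | hM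
  · omega
  have hM' : (0 : ℝ) < M := by exact_mod_cast hM
  by_contra! hcon
  set s := Finset.univ.filter fun m => errorProb q c m ≤ 2 * avgErrorProb q c with hs
  set t := Finset.univ.filter fun m => ¬ errorProb q c m ≤ 2 * avgErrorProb q c with ht
  have hst : s.card + t.card = M := by
    rw [hs, ht, Finset.card_filter_add_card_filter_not, Finset.card_univ, Fintype.card_fin]
  have htne : t.Nonempty := Finset.card_pos.1 (by omega)
  have h1 : ∑ _m ∈ t, 2 * avgErrorProb q c < ∑ m ∈ t, errorProb q c m :=
    Finset.sum_lt_sum_of_nonempty htne fun m hm => not_le.1 (Finset.mem_filter.1 hm).2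
  have h2 : ∑ m ∈ t, errorProb q c m ≤ ∑ m, errorProb q c m :=
    Finset.sum_le_sum_of_subset_of_nonneg (Finset.subset_univ t)
      fun m _ _ => errorProb_nonneg q c m
  have h3 : ∑ m, errorProb q c m = M * avgErrorProb q c := by
    rw [avgErrorProb]; field_simp
  have h4 : 0 ≤ avgErrorProb q c :=
    div_nonneg (Finset.sum_nonneg fun m _ => errorProb_nonneg q c m) hM'.le
  have h5 : (M : ℝ) ≤ 2 * t.card := by exact_mod_cast (by omega : M ≤ 2 * t.card)
  rw [Finset.sum_const, nsmul_eq_mul] at h1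
  nlinarith

/-- The sum is linear in the joint type, so a mixture of products gives an average of quadratic
forms, each at most E, and the approximation costs at most ΔD for each pair of letters. -/
lemma sum_le_of_jointType_near_mixture [Fintype X] {n : ℕ} (hn : 0 < n) {x x' : Fin n → X}
    {Δ D E : ℝ} {Q : Fin n → X → ℝ} (hQ : ∀ t, Q t ∈ stdSimplex ℝ X)
    (hnear : ∀ a b, |jointType x x' a b - (∑ t, Q t a * Q t b) / n| ≤ Δ) {g : X → X → ℝ}
    (hg : ∀ a b, |g a b| ≤ D) (hE : ∀ Q ∈ stdSimplex ℝ X, quadForm g Q ≤ E) :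
    ∑ t, g (x t) (x' t) ≤ n * (E + (Fintype.card X : ℝ) ^ 2 * (Δ * D)) := by
  have hn' : (0 : ℝ) < n := by exact_mod_cast hn
  rw [sum_eq_sum_jointType hn]
  refine mul_le_mul_of_nonneg_left ?_ hn'.le
  have h1 : ∀ a b, jointType x x' a b * g a b ≤
      (∑ t, Q t a * Q t b) / n * g a b + Δ * D := by
    intro a b
    have h2 := (le_abs_self _).trans_eq (abs_mul (jointType x x' a b - (∑ t, Q t a * Q t b) / n)
      (g a b))
    have h3 := mul_le_mul (hnear a b) (hg a b) (abs_nonneg _) ((abs_nonneg _).trans (hnear a b))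
    linarith
  have h4 : ∑ a, ∑ b, (∑ t, Q t a * Q t b) / n * g a b = (∑ t, quadForm g (Q t)) / n := by
    simp_rw [quadForm, Finset.sum_div, Finset.sum_mul]
    symm
    rw [Finset.sum_comm]
    refine Finset.sum_congr rfl fun a _ => ?_
    rw [Finset.sum_comm]
    refine Finset.sum_congr rfl fun b _ => Finset.sum_congr rfl fun t _ => ?_
    ring
  calc ∑ a, ∑ b, jointType x x' a b * g a b
      ≤ ∑ a, ∑ b, ((∑ t, Q t a * Q t b) / n * g a b + Δ * D) :=
        Finset.sum_le_sum fun a _ => Finset.sum_le_sum fun b _ => h1 a b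
    _ = (∑ t, quadForm g (Q t)) / n + (Fintype.card X : ℝ) ^ 2 * (Δ * D) := by
        simp only [Finset.sum_add_distrib, h4, Finset.sum_const, Finset.card_univ, nsmul_eq_mul]
        ring
    _ ≤ E + (Fintype.card X : ℝ) ^ 2 * (Δ * D) := by
        refine add_le_add_left ?_ _
        rw [div_le_iff₀ hn']
        calc ∑ t, quadForm g (Q t) ≤ ∑ _t : Fin n, E :=
              Finset.sum_le_sum fun t _ => hE _ (hQ t)
          _ = E * n := by simp [mul_comm]

/-- The error probability of long codes of rate at least `R > 0` decays at most with exponent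
`E + θ`, if `E` bounds all the quadratic forms of `μ̂(s)` on the simplex. -/
theorem Confusable.exists_exp_le_avgErrorProb [Fintype X] (hq : Confusable q) {E : ℝ}
    (hE : ∀ s, 0 ≤ s → ∀ Q ∈ stdSimplex ℝ X,
      quadForm (fun a b => realMu q (hatSupport q a b) a b s) Q ≤ E) {R θ : ℝ} (hR : 0 < R)
    (hθ : 0 < θ) : ∃ n₀ : ℕ, ∀ n, n₀ ≤ n → ∀ (M : ℕ) (c : Fin M → Fin n → X), 0 < M →
      R ≤ rate M n → Real.exp (-(n * (E + θ))) ≤ avgErrorProb q c := by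
  obtain ⟨S, hS, n₁, hpair⟩ := hq.exists_exp_le_pairError_of_ordered (by positivity : 0 < θ / 4)
  obtain ⟨D, hD0, hD⟩ : ∃ D : ℝ, 0 ≤ D ∧ ∀ a b s, 0 ≤ s → s ≤ S →
      |realMu q (hatSupport q a b) a b s| ≤ D := by
    have : ∀ p : X × X, ∃ D : ℝ, ∀ s ∈ Set.Icc 0 S,
        ‖realMu q (hatSupport q p.1 p.2) p.1 p.2 s‖ ≤ D := fun p =>
      isCompact_Icc.exists_bound_of_continuousOn
        (hq.continuous_realMu (tightSupport_subset_hatSupport q p.1 p.2)).continuousOn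
    choose D hD using this
    obtain ⟨B, hB⟩ := Finite.bddAbove_range D
    exact ⟨max B 0, le_max_right _ _, fun a b s h0 h1 =>
      (hD (a, b) s ⟨h0, h1⟩).trans ((hB ⟨(a, b), rfl⟩).trans (le_max_left _ _))⟩
  set κ : ℝ := (Fintype.card X : ℝ) ^ 2 with hκ
  have hκ0 : 0 ≤ κ := by positivity
  set Δ : ℝ := θ / (4 * (κ * D + 1)) with hΔ
  have hΔ0 : 0 < Δ := by positivity
  have hΔ1 : κ * (Δ * D) ≤ θ / 4 := by
    rw [hΔ, div_mul_eq_mul_div, mul_div_assoc', div_le_div_iff₀ (by positivity) (by norm_num)]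
    nlinarith [mul_nonneg hκ0 hD0]
  obtain ⟨N, hN⟩ := exists_jointType_near_mixture X hΔ0
  obtain ⟨n₂, hn₂⟩ := exists_nat_ge (2 * N / R)
  obtain ⟨n₃, hn₃⟩ := exists_nat_ge (4 / θ)
  refine ⟨max (max n₁ n₂) (max n₃ 1), fun n hn M c hM hrate => ?_⟩
  have hnpos : 0 < n := by omega
  have hn' : (0 : ℝ) < n := by exact_mod_cast hnpos
  have hM' : (0 : ℝ) < M := by exact_mod_cast hM
  have hnθ : 4 ≤ n * θ := by
    have h1 : (n₃ : ℝ) ≤ n := by exact_mod_cast (by omega : n₃ ≤ n)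
    have := hn₃.trans h1
    rwa [div_le_iff₀ hθ] at this
  have hMN : 2 * N ≤ M := by
    have h1 : (n₂ : ℝ) ≤ n := by exact_mod_cast (by omega : n₂ ≤ n)
    have h2 := hn₂.trans h1
    rw [div_le_iff₀ hR] at h2
    rw [rate, le_div_iff₀ hn'] at hrate
    have h3 := Real.exp_le_exp.2 hrate
    rw [Real.exp_log hM'] at h3
    -- Only M → ∞ with n is needed, so the linear lower bound for exp(Rn) suffices.
    have h4 := Real.add_one_le_exp (R * n)
    have h5 : (2 * N : ℝ) ≤ M := by linarith
    exact_mod_cast h5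
  have hcard := card_le_two_mul_card_errorProb_le q c
  obtain ⟨i, hi, j, hj, hij, Q, hQ, hnear⟩ := hN (Fin M) n hnpos c
    (Finset.univ.filter fun m => errorProb q c m ≤ 2 * avgErrorProb q c) (by omega)
  -- The factor 1/4 combines tie breaking with the passage to the better half; it is absorbed by the
  -- remaining exponent nθ/2 ≥ 2.
  have hquarter : Real.exp (-2) ≤ 1 / 4 := by
    have h1 : (2 : ℝ) ≤ Real.exp 1 := by have := Real.add_one_le_exp (1 : ℝ); linarith
    have h2 : Real.exp (2 : ℝ) = Real.exp 1 * Real.exp 1 := by rw [← Real.exp_add]; norm_num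
    rw [Real.exp_neg, one_div]
    exact inv_anti₀ (by norm_num) (by nlinarith)
  have key : ∀ k l : Fin M, k ≠ l → errorProb q c k ≤ 2 * avgErrorProb q c →
      (∀ a b, |jointType (c k) (c l) a b - (∑ t, Q t a * Q t b) / n| ≤ Δ) →
      ∑ t, (maxLogRatio q (c k t) (c l t) + maxLogRatio q (c l t) (c k t)) ≤
        2 * ∑ t, maxLogRatio q (c k t) (c l t) →
      Real.exp (-(n * (E + θ))) ≤ avgErrorProb q c := by
    intro k l hkl hk hnear hord
    have h1 := hpair n (by omega) (c k) (c l) (E + θ / 4) (fun s h0 h1 =>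
      (sum_le_of_jointType_near_mixture hnpos hQ hnear (fun a b => hD a b s h0 h1)
        (hE s h0)).trans (mul_le_mul_of_nonneg_left (by linarith) hn'.le)) hord
    have h2 := pairError_le_errorProb (q := q) c hkl
    have h3 : Real.exp (-(n * (E + θ))) ≤
        Real.exp (-(n * (E + θ / 4 + θ / 4))) * Real.exp (-2) := by
      rw [← Real.exp_add]
      exact Real.exp_le_exp.2 (by linarith)
    have h4 := mul_le_mul_of_nonneg_left hquarter (Real.exp_pos (-(n * (E + θ / 4 + θ / 4)))).le
    linarith
  simp only [Finset.mem_filter, Finset.mem_univ, true_and] at hi hj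
  rcases le_total (∑ t, maxLogRatio q (c j t) (c i t)) (∑ t, maxLogRatio q (c i t) (c j t))
    with h | h
  · refine key i j hij hi hnear ?_
    rw [Finset.sum_add_distrib]; linarith
  -- Exchanging the codewords transposes the joint type, and the mixture of products Q ⊗ Q is
  -- unchanged, so both orders are available.
  · refine key j i hij.symm hj (fun a b => ?_) ?_
    · rw [jointType_comm]
      simpa only [mul_comm] using hnear b a
    · rw [Finset.sum_add_distrib]; linarith

lemma reliability_antitone (q : DecodingMetric W) : Antitone (reliability q) := by
  intro R R' h
  refine limsup_le_limsup (Eventually.of_forall fun n => ?_)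
  refine EReal.div_le_div_right_of_nonneg (by exact_mod_cast Nat.zero_le n) ?_
  refine EReal.neg_le_neg_iff.2 (ENNReal.log_monotone ?_)
  refine iInf_mono fun M => iInf_mono fun c => ?_
  exact le_iInf fun hc => iInf_le_of_le ⟨hc.1, h.trans hc.2⟩ le_rfl

theorem Confusable.reliability_le [Fintype X] (hq : Confusable q) {E : ℝ}
    (hE : ∀ s, 0 ≤ s → ∀ Q ∈ stdSimplex ℝ X,
      quadForm (fun a b => realMu q (hatSupport q a b) a b s) Q ≤ E) {R : ℝ} (hR : 0 < R) :
    reliability q R ≤ E := by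
  refine EReal.le_of_forall_lt_iff_le.1 fun z hz => ?_
  have hz' : 0 < z - E := sub_pos.2 (EReal.coe_lt_coe_iff.1 hz)
  obtain ⟨n₀, h⟩ := hq.exists_exp_le_avgErrorProb hE hR hz'
  refine limsup_le_of_le (by isBoundedDefault) ?_
  filter_upwards [eventually_ge_atTop (max n₀ 1)] with n hn
  have hn' : (0 : ℝ) < n := by exact_mod_cast (by omega : 0 < n)
  have h1 : ENNReal.ofReal (Real.exp (-(n * z))) ≤ minErrorProb q R n := by
    refine le_iInf fun M => le_iInf fun c => le_iInf fun hc => ENNReal.ofReal_le_ofReal ?_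
    have := h n (by omega) M c hc.1 hc.2
    rwa [add_sub_cancel] at this
  have h2 := ENNReal.log_monotone h1
  rw [ENNReal.log_ofReal_of_pos (Real.exp_pos _), Real.log_exp] at h2
  have h3 : -ENNReal.log (minErrorProb q R n) ≤ ((n * z : ℝ) : EReal) := by
    rw [EReal.neg_le, ← EReal.coe_neg]; exact h2
  rw [EReal.div_le_iff_le_mul (by exact_mod_cast hn') (EReal.natCast_ne_top n)]
  refine h3.trans_eq ?_
  rw [EReal.coe_mul]
  rfl

end Codes

end Mismatch

/-! ### The main theorem -/

theorem theorem5 {X Y : Type*} [Fintype X] [Nonempty X] [Fintype Y]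
    (W : Mismatch.DMC X Y) (q : Mismatch.DecodingMetric W)
    (hC : Mismatch.zeroErrorCapacity q = 0) :
    ∃ (E₀ : EReal) (Eup Eex G : ℝ),
      Tendsto (Mismatch.reliability q) (𝓝[>] (0 : ℝ)) (𝓝 E₀) ∧
      IsGreatest (Mismatch.supForm (Mismatch.muHat q) '' stdSimplex ℝ X) (Eup : EReal) ∧
      IsGreatest (Mismatch.supForm (Mismatch.mu q) '' stdSimplex ℝ X) (Eex : EReal) ∧
      IsGreatest (Mismatch.gapTerm q '' Mismatch.tightPairs q) G ∧
      E₀ ≤ (Eup : EReal) ∧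
      |Eup - Eex| ≤ G / 2 := by
  have hq := Mismatch.confusable_of_zeroErrorCapacity_eq_zero hC
  obtain ⟨Eup, hup⟩ := hq.exists_isGreatest_supForm_realMu
    (Mismatch.tightSupport_subset_hatSupport q) (Mismatch.hatSupport_subset_jointSupport q)
    hq.muHat_eq
  obtain ⟨Eex, hex⟩ := hq.exists_isGreatest_supForm_realMu
    (Mismatch.tightSupport_subset_jointSupport q) (fun _ _ => subset_rfl) hq.mu_eq
  obtain ⟨G, hG⟩ : ∃ G, IsGreatest (Mismatch.gapTerm q '' Mismatch.tightPairs q) G := by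
    obtain ⟨a⟩ := ‹Nonempty X›
    obtain ⟨G, hG, hle⟩ := Set.exists_max_image (Mismatch.gapTerm q '' Mismatch.tightPairs q) id
      ((Set.toFinite _).image _) ⟨_, (a, a), hq.self_mem_tightPairs a, rfl⟩
    exact ⟨G, hG, hle⟩
  have hE : ∀ s, 0 ≤ s → ∀ Q ∈ stdSimplex ℝ X, Mismatch.quadForm
      (fun a b => Mismatch.realMu q (Mismatch.hatSupport q a b) a b s) Q ≤ Eup := by
    intro s hs Q hQ
    rw [← EReal.coe_le_coe_iff]
    refine le_trans ?_ (hup.2 ⟨Q, hQ, rfl⟩)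
    rw [Mismatch.supForm_eq hq.muHat_eq]
    exact le_iSup₂ (f := fun s (_ : 0 ≤ s) => ((Mismatch.quadForm
      (fun a b => Mismatch.realMu q (Mismatch.hatSupport q a b) a b s) Q : ℝ) : EReal)) s hs
  -- By monotonicity the limit at 0⁺ exists and is the supremum over R > 0, so a bound at each
  -- positive rate is enough.
  refine ⟨_, Eup, Eex, G, (Mismatch.reliability_antitone q).tendsto_nhdsGT 0, hup, hex, hG, ?_,
    hq.abs_sub_le_half_gap hup hex hG⟩
  refine sSup_le ?_
  rintro _ ⟨R, hR, rfl⟩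
  exact hq.reliability_le hE hR
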